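/- Let $(R,\mathfrak m,k)$ be a Noetherian local ring, let $e>0$, let $G\cong R^e$, and let $E\subsetneq G$ be an ideal module, i.e. a proper submodule with $\operatorname{grade} G/E\ge 2$ (such an $E$ is torsionfree of rank $e$). **Notation.** For a finitely generated module $M$ over a Noetherian local ring $S$, $\mu(M)$ is the minimal number of generators, $F_i(M)$ the $i$-th Fitting ideal, and $\ell(M)$ the analytic spread, i.e. the Krull dimension of $\mathcal R(M)\otimes_S S/\mathfrak n$, where $\mathfrak n$ is the maximal ideal of $S$ and $\mathcal R(M)$ is the symmetric algebra of $M$ modulo its $S$-torsion. A module $M$ of rank $r>0$ is *of the principal class* if $\mu(M)=\operatorname{ht}F_r(M)+r-1$, and *equimultiple* if $\ell(M)=\operatorname{ht}F_r(M)+r-1$. An ideal $I$ is of the principal class if $\mu(I)=\operatorname{ht} I$, and equimultiple if $\ell(I)=\operatorname{ht} I$. A *good generic Bourbaki ideal* of $E$ is obtained as follows. Take generators $a_1,\dots,a_n$ of $E$ and indeterminates $\mathbf Z=\{z_{ij}: 1\le i\le n,\ 1\le j\le e-1\}$. Put $R''=R[\mathbf Z]_{\mathfrak m R[\mathbf Z]}$,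 $E''=E\otimes_R R''$, $x_j=\sum_{i} z_{ij}a_i\in E''$ and $F=\sum_{j=1}^{e-1}R''x_j$. It is any ideal $I$ of $R''$ with $I\cong E''/F$ as $R''$-modules and $\operatorname{grade} I\ge 2$. **Statement.** 1. If $\mu(E)=e+1$, then $E$ is of the principal class, and every good generic Bourbaki ideal $I$ of $E$ is of the principal class (both as an ideal and as a module of rank $1$). 2. If $\ell(E)=e+1$ and $k$ is infinite, then $E$ is equimultiple, and every good generic Bourbaki ideal $I$ of $E$ is equimultiple (both as an ideal and as a module of rank $1$). In both cases $$\operatorname{grade}F_e(E)=\operatorname{ht}F_e(E)=2,$$ and every good generic Bourbaki ideal $I$ of $E$ satisfies $$\operatorname{ht} I=\operatorname{grade} I=2 .$$ -/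

import Mathlib

open scoped TensorProduct

namespace DivisorsOfModule

universe u v

section Invariants

variable (R : Type u) [CommRing R] (M : Type v) [AddCommGroup M] [Module R M]

/-- The grade of an ideal `I`: the supremum of the lengths of the `R`-regular sequences contained
in `I`. In a proper ideal "weakly regular" and "regular" mean the same; for the unit ideal the value
is `⊤`, which is the usual convention. -/
noncomputable def idealGrade {R : Type u} [CommRing R] (I : Ideal R) : ℕ∞ :=
  ⨆ (rs : List R) (_ : (∀ r ∈ rs, r ∈ I) ∧ RingTheory.Sequence.IsWeaklyRegular R rs),
    (rs.length : ℕ∞)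

/-- The grade of a module: `grade M = grade (Ann M)` (so it is `⊤` for `M = 0`). -/
noncomputable def moduleGrade : ℕ∞ :=
  idealGrade (Module.annihilator R M)

/-- `μ(M)`: the minimal number of generators of a finitely generated module. -/
noncomputable def minGens : ℕ :=
  (⊤ : Submodule R M).spanFinrank

/-- The `i`-th Fitting ideal `F_i(M)` of a finitely generated module. For a generating family
`x : Fin n → M` it is generated by the `(n - i) × (n - i)` minors of the relations of `x`
(the vectors `ρ k` are `n - i` relations, `s` selects `n - i` coordinates; a `0 × 0` minor is `1`).
This ideal does not depend on the generating family, so one may let the latter vary. -/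
noncomputable def fittingIdeal (i : ℕ) : Ideal R :=
  Ideal.span {d : R | ∃ (n : ℕ) (x : Fin n → M), Submodule.span R (Set.range x) = ⊤ ∧
    ∃ (ρ : Fin (n - i) → Fin n → R) (s : Fin (n - i) → Fin n),
      (∀ k, ∑ j, ρ k j • x j = 0) ∧ d = (Matrix.of fun k l => ρ k (s l)).det}

/-- The `R`-torsion of the symmetric algebra `S(M)`: the elements that are killed by some
nonzerodivisor of `R`. It is an ideal of `S(M)`. -/
def symTorsion : Ideal (SymmetricAlgebra R M) where
  carrier := {s | ∃ a ∈ nonZeroDivisors R, a • s = 0}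
  zero_mem' := ⟨1, one_mem _, smul_zero _⟩
  add_mem' := by
    rintro s t ⟨a, ha, hs⟩ ⟨b, hb, ht⟩
    refine ⟨a * b, mul_mem ha hb, ?_⟩
    rw [smul_add, mul_comm a b, mul_smul, hs, mul_comm b a, mul_smul, ht]
    simp
  smul_mem' := by
    rintro c s ⟨a, ha, hs⟩
    refine ⟨a, ha, ?_⟩
    rw [smul_eq_mul, ← mul_smul_comm, hs, mul_zero]

/-- The Rees algebra of a module: the symmetric algebra modulo its `R`-torsion. -/
abbrev ReesAlg : Type (max u v) :=
  SymmetricAlgebra R M ⧸ symTorsion R M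

/-- The fiber cone of a module over a local ring: the Rees algebra modulo the extension of the
maximal ideal of `R`. -/
abbrev FiberCone [IsLocalRing R] : Type (max u v) :=
  ReesAlg R M ⧸ (IsLocalRing.maximalIdeal R).map (algebraMap R (ReesAlg R M))

/-- The analytic spread `ℓ(M)`: the Krull dimension of the fiber cone. -/
noncomputable def analyticSpread [IsLocalRing R] : WithBot ℕ∞ :=
  ringKrullDim (FiberCone R M)

/-- A module of rank `e > 0` is of the principal class if `μ(M) = ht F_e(M) + e - 1`. -/
def IsPrincipalClass (e : ℕ) : Prop :=
  (minGens R M : ℕ∞) + 1 = (fittingIdeal R M e).height + e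

/-- A module of rank `e > 0` is equimultiple if its analytic deviation
`ℓ(M) - e + 1 - ht F_e(M)` is zero. -/
def IsEquimultiple [IsLocalRing R] (e : ℕ) : Prop :=
  analyticSpread R M + 1 = ((fittingIdeal R M e).height : WithBot ℕ∞) + e

/-- An ideal is of the principal class if `μ(I) = ht I`. -/
def IsPrincipalClassIdeal {R : Type u} [CommRing R] (I : Ideal R) : Prop :=
  (minGens R I : ℕ∞) = I.height

/-- An ideal of a local ring is equimultiple if `ℓ(I) = ht I`. -/
def IsEquimultipleIdeal {R : Type u} [CommRing R] [IsLocalRing R] (I : Ideal R) : Prop :=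
  analyticSpread R I = (I.height : WithBot ℕ∞)

end Invariants

/-- `E ⊆ G` is an ideal module, where `G ≅ R^e`: the grade of `G/E` is at least two. (`E` is
torsionfree because it is a submodule of a free module, and it has rank `e` because `G/E` is
killed by a nonzerodivisor.) -/
def IsIdealModule {R : Type u} [CommRing R] {G : Type v} [AddCommGroup G] [Module R G]
    (e : ℕ) (E : Submodule R G) : Prop :=
  Nonempty (G ≃ₗ[R] (Fin e → R)) ∧ 2 ≤ moduleGrade R (G ⧸ E)

section Nagata

variable (R : Type u) [CommRing R] [IsLocalRing R]

/-- The extension of the maximal ideal of `R` to the polynomial ring `R[Z]`. -/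
noncomputable def maxIdealExt (σ : Type) : Ideal (MvPolynomial σ R) :=
  (IsLocalRing.maximalIdeal R).map MvPolynomial.C

instance maxIdealExt_isPrime (σ : Type) : (maxIdealExt R σ).IsPrime := by
  have h : maxIdealExt R σ = RingHom.ker (MvPolynomial.map (σ := σ) (IsLocalRing.residue R)) := by
    rw [MvPolynomial.ker_map, IsLocalRing.ker_residue]
    rfl
  rw [h]
  exact RingHom.ker_isPrime _

/-- The Nagata extension `R(Z) = R[Z]_{𝔪 R[Z]}` in a set of indeterminates indexed by `σ`. -/
def Nagata (σ : Type) : Type u :=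
  Localization.AtPrime (maxIdealExt R σ)

noncomputable instance (σ : Type) : CommRing (Nagata R σ) :=
  inferInstanceAs (CommRing (Localization.AtPrime (maxIdealExt R σ)))

instance (σ : Type) : IsLocalRing (Nagata R σ) :=
  inferInstanceAs (IsLocalRing (Localization.AtPrime (maxIdealExt R σ)))

noncomputable instance (σ : Type) : Algebra (MvPolynomial σ R) (Nagata R σ) :=
  inferInstanceAs (Algebra (MvPolynomial σ R) (Localization.AtPrime (maxIdealExt R σ)))

instance (σ : Type) : IsLocalization.AtPrime (Nagata R σ) (maxIdealExt R σ) :=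
  inferInstanceAs (IsLocalization.AtPrime (Localization.AtPrime (maxIdealExt R σ))
    (maxIdealExt R σ))

noncomputable instance (σ : Type) : Algebra R (Nagata R σ) :=
  inferInstanceAs (Algebra R (Localization.AtPrime (maxIdealExt R σ)))

instance (σ : Type) : IsScalarTower R (MvPolynomial σ R) (Nagata R σ) :=
  inferInstanceAs (IsScalarTower R (MvPolynomial σ R) (Localization.AtPrime (maxIdealExt R σ)))

/-- The indeterminate `z_i` in the Nagata extension. -/
noncomputable def nagataVar {σ : Type} (i : σ) : Nagata R σ :=
  algebraMap (MvPolynomial σ R) (Nagata R σ) (MvPolynomial.X i)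

variable {M : Type v} [AddCommGroup M] [Module R M]

/-- The submodule `F` of `M'' = R'' ⊗ M` generated by the `m` generic elements
`x_j = ∑ i, z_{ij} a_i`, where `R'' = R(z_{ij})`. -/
noncomputable def genericSubmodule {n : ℕ} (a : Fin n → M) (m : ℕ) :
    Submodule (Nagata R (Fin n × Fin m)) (Nagata R (Fin n × Fin m) ⊗[R] M) :=
  Submodule.span _ (Set.range fun j : Fin m => ∑ i : Fin n, nagataVar R (i, j) ⊗ₜ[R] a i)

/-- `I` is a good generic Bourbaki ideal of the module `M` of rank `e`, constructed from the
generating family `a` of `M`: it is an ideal of `R'' = R(z_{ij} | i ≤ n, j ≤ e - 1)` that is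
isomorphic to `M''/F`, with `F` generated by the `e - 1` generic elements, and `grade I ≥ 2`. -/
def IsGoodGenericBourbakiIdeal {n : ℕ} (a : Fin n → M) (e : ℕ)
    (I : Ideal (Nagata R (Fin n × Fin (e - 1)))) : Prop :=
  Submodule.span R (Set.range a) = ⊤ ∧
  Nonempty (((Nagata R (Fin n × Fin (e - 1)) ⊗[R] M) ⧸ genericSubmodule R a (e - 1))
    ≃ₗ[Nagata R (Fin n × Fin (e - 1))] I) ∧
  2 ≤ idealGrade I

end Nagata

end DivisorsOfModule

open DivisorsOfModule

/-! Both hypotheses say that `E` has a reduction by `e + 1` elements: a generating family (reduction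
number `0`) if `μ(E) = e + 1`, and `e + 1` general elements (`exists_hasReduction`) if `ℓ(E) = e +
1` and the residue field is infinite. From there the two statements share one argument.

Height of `F_e(E)`: this ideal has the same radical as `Ann(G/E)`
(`IsIdealModule.fittingIdeal_le_iff`), so its grade is at least two. For the upper bound, let `U` be
generated by the reduction. A functional from `G` to a residue field that kills `U` extends from `E`
to the Rees algebra, so its values on `E` are nilpotent, hence zero. Thus `G/U` and `G/E` have the
same support, and `G/U` is the cokernel of an `e × (e + 1)` matrix, whose minimal primes have height
at most two (`height_le_two_of_mem_minimalPrimes_cokerAnn`).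

Bourbaki ideals: Nakayama's lemma at a specialization of the indeterminates (`mem_span_of_generic`)
allows `e - 1` members of the reduction to be traded for the generic elements. These vanish in `I ≅
E''/F`, so the other two members give a reduction of `I` with the same reduction number
(`hasReduction_bourbaki`). As `I` is proper (`bourbaki_ne_top`), `ht I ≤ 2`, while its grade gives
`ht I ≥ 2`. Then `μ(I)` or `ℓ(I)` is squeezed between the height and the size of the reduction, and
`F_1(I)` has height two because `I` is itself an ideal module of rank one. -/

namespace DivisorsOfModule
-- Grade, height and regular sequences of length two
section Grade

variable {R : Type*} [CommRing R]

/-- A sequence is weakly regular iff each member is a nonzerodivisor modulo its predecessors. -/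
theorem isWeaklyRegular_iff_mem (rs : List R) :
    RingTheory.Sequence.IsWeaklyRegular R rs ↔ ∀ i (h : i < rs.length) (x : R),
      rs[i] * x ∈ Ideal.ofList (rs.take i) → x ∈ Ideal.ofList (rs.take i) := by
  rw [RingTheory.Sequence.isWeaklyRegular_iff]
  refine forall₂_congr fun i h => ?_
  rw [isSMulRegular_on_quot_iff_lsmul_comap_le, SetLike.le_def]
  simp

/-- Elements of a minimal prime over an ideal are zerodivisors modulo that ideal, so the next member
of the sequence avoids every minimal prime over its predecessors and forces a strict inclusion of
primes. -/
theorem length_le_height_of_isWeaklyRegular [IsNoetherianRing R] {rs : List R}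
    (h : RingTheory.Sequence.IsWeaklyRegular R rs) (i : ℕ) (hi : i ≤ rs.length)
    (Q : Ideal R) [hQ : Q.IsPrime] (hle : Ideal.ofList (rs.take i) ≤ Q) : (i : ℕ∞) ≤ Q.height := by
  induction i generalizing Q with
  | zero => simp
  | succ i ih =>
    have hile : Ideal.ofList (rs.take i) ≤ Q := by
      refine le_trans ?_ hle
      rw [List.take_add_one, Ideal.ofList_append]
      exact le_sup_left
    obtain ⟨Q₀, hQ₀, hQ₀Q⟩ := Ideal.exists_minimalPrimes_le hile
    have : Q₀.IsPrime := hQ₀.1.1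
    have hrQ : rs[i] ∈ Q := by
      apply hle
      apply Ideal.subset_span
      simp [List.mem_take_iff_getElem]
      exact ⟨i, ⟨by omega, by omega⟩, rfl⟩
    have hrQ₀ : rs[i] ∉ Q₀ := by
      intro hr
      obtain ⟨y, hy, hxy⟩ := Ideal.exists_mul_mem_of_mem_minimalPrimes hQ₀ hr
      exact hy ((isWeaklyRegular_iff_mem rs).1 h i (by omega) y (by simpa [mul_comm] using hxy))
    have hlt : Q₀ < Q := lt_of_le_of_ne hQ₀Q (fun he => hrQ₀ (he ▸ hrQ))
    have := ih (by omega) Q₀ hQ₀.1.2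
    have h2 := Ideal.height_add_one_le_of_lt_of_isPrime hlt
    push_cast
    exact (add_le_add_left this 1).trans h2

theorem idealGrade_le_height [IsNoetherianRing R] (I : Ideal R) : idealGrade I ≤ I.height := by
  refine iSup₂_le fun rs hrs => ?_
  rw [Ideal.height_eq_inf_minimalPrimes]
  refine le_iInf₂ fun Q hQ => ?_
  have := hQ.1.1
  refine length_le_height_of_isWeaklyRegular hrs.2 rs.length le_rfl Q ?_
  rw [Ideal.ofList, Ideal.span_le]
  intro r hr
  exact hQ.1.2 (hrs.1 r (List.mem_of_mem_take hr))

/-- An ideal of grade at least two contains a regular sequence of length two; the converse holds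
up to radical. -/
theorem exists_pair_of_two_le_idealGrade {I : Ideal R} (h : 2 ≤ idealGrade I) :
    ∃ a ∈ I, ∃ b ∈ I, (∀ x, a * x = 0 → x = 0) ∧ ∀ x y, b * x = a * y → ∃ z, x = a * z := by
  have : ∃ rs : List R, ((∀ r ∈ rs, r ∈ I) ∧ RingTheory.Sequence.IsWeaklyRegular R rs) ∧
      2 ≤ rs.length := by
    by_contra! hc
    have : idealGrade I ≤ 1 := iSup₂_le fun rs hrs => by
      have := hc rs hrs
      exact_mod_cast (by omega : rs.length ≤ 1)
    have := h.trans this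
    exact absurd this (by decide)
  obtain ⟨rs, ⟨hI, hreg⟩, hlen⟩ := this
  rw [isWeaklyRegular_iff_mem] at hreg
  match rs, hlen with
  | a :: b :: rs, _ =>
    refine ⟨a, hI a (by simp), b, hI b (by simp), fun x hx => ?_, fun x y hxy => ?_⟩
    · simpa using hreg 0 (by simp) x (by simp [hx])
    · have := hreg 1 (by simp) x (by
        simp only [List.getElem_cons_succ, List.getElem_cons_zero, List.take_succ_cons, List.take_zero,
          Ideal.ofList_singleton, Ideal.mem_span_singleton]
        exact ⟨y, hxy⟩)
      simpa [Ideal.mem_span_singleton, Dvd.dvd] using this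

theorem two_le_idealGrade_of_pair {I : Ideal R} {a b : R} (ha : a ∈ I) (hb : b ∈ I)
    (h1 : ∀ x, a * x = 0 → x = 0) (h2 : ∀ x y, b * x = a * y → ∃ z, x = a * z) :
    2 ≤ idealGrade I := by
  have : RingTheory.Sequence.IsWeaklyRegular R [a, b] := by
    rw [isWeaklyRegular_iff_mem]
    intro i hi x hx
    simp only [List.length_cons, List.length_nil, zero_add, Nat.reduceAdd] at hi
    interval_cases i
    · simpa using h1 x (by simpa using hx)
    · simp [Ideal.mem_span_singleton, Dvd.dvd] at hx ⊢
      obtain ⟨y, hy⟩ := hx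
      exact h2 x y hy
  have := le_iSup₂ (f := fun (rs : List R) (_ : (∀ r ∈ rs, r ∈ I) ∧
    RingTheory.Sequence.IsWeaklyRegular R rs) => (rs.length : ℕ∞)) [a, b]
    ⟨by simp [ha, hb], this⟩
  exact le_trans (by simp) this

/-- If `a, b` is a regular pair, so is `a ^ s, b ^ t`, and suitable powers lie in `J`. -/
theorem two_le_idealGrade_of_le_radical {I J : Ideal R} (hIJ : I ≤ J.radical)
    (h : 2 ≤ idealGrade I) : 2 ≤ idealGrade J := by
  obtain ⟨a, ha, b, hb, h1, h2⟩ := exists_pair_of_two_le_idealGrade h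
  obtain ⟨s, hs⟩ := hIJ ha
  obtain ⟨t, ht⟩ := hIJ hb
  have h1' : ∀ s x, a ^ s * x = 0 → x = 0 := by
    intro s
    induction s with
    | zero => simp
    | succ s ih => intro x hx; exact h1 _ (ih _ (by rw [← hx]; ring))
  have h2' : ∀ s x y, b * x = a ^ s * y → ∃ z, x = a ^ s * z := by
    intro s
    induction s with
    | zero => intro x y _; exact ⟨x, by simp⟩
    | succ s ih =>
      intro x y hxy
      obtain ⟨z, rfl⟩ := h2 x (a ^ s * y) (by rw [hxy]; ring)
      have : b * z = a ^ s * y := by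
        have := h1 (b * z - a ^ s * y) (by linear_combination hxy)
        linear_combination this
      obtain ⟨w, rfl⟩ := ih z y this
      exact ⟨w, by ring⟩
  have h3' : ∀ t x y, b ^ t * x = a ^ s * y → ∃ z, x = a ^ s * z := by
    intro t
    induction t with
    | zero => intro x y h; exact ⟨y, by simpa using h⟩
    | succ t ih =>
      intro x y hxy
      obtain ⟨z, hz⟩ := ih (b * x) y (by rw [← hxy]; ring)
      exact h2' s x z hz
  exact two_le_idealGrade_of_pair hs ht (h1' s) (h3' t)

theorem idealGrade_eq_two_of_height_eq_two [IsNoetherianRing R] {I : Ideal R}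
    (h : 2 ≤ idealGrade I) (h2 : I.height = 2) : idealGrade I = 2 :=
  le_antisymm ((idealGrade_le_height I).trans h2.le) h

end Grade

/-! ### Degeneracy loci of matrices and Schur complements -/

section Degeneracy

variable {R : Type*} [CommRing R] {m n : ℕ}

/-- The annihilator of the cokernel of a matrix. -/
def cokerAnn (φ : Matrix (Fin m) (Fin n) R) : Ideal R :=
  Module.annihilator R ((Fin m → R) ⧸ LinearMap.range φ.mulVecLin)

theorem mem_cokerAnn {φ : Matrix (Fin m) (Fin n) R} {c : R} :
    c ∈ cokerAnn φ ↔ ∀ v : Fin m → R, ∃ b, φ.mulVec b = c • v := by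
  rw [cokerAnn, Module.mem_annihilator]
  constructor
  · intro h v
    have := h (Submodule.Quotient.mk v)
    rw [← Submodule.Quotient.mk_smul, Submodule.Quotient.mk_eq_zero] at this
    simpa using this
  · intro h x
    obtain ⟨v, rfl⟩ := Submodule.Quotient.mk_surjective _ x
    rw [← Submodule.Quotient.mk_smul, Submodule.Quotient.mk_eq_zero]
    simpa using h v

/-- A functional with values in a domain that kills the columns of a matrix also kills the
annihilator of the cokernel. -/
theorem map_eq_zero_of_mem_cokerAnn {K : Type*} [CommRing K] [IsDomain K] (χ : R →+* K)
    {φ : Matrix (Fin m) (Fin n) R} {w : Fin m → K} (hw : w ≠ 0)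
    (hφ : ∀ j, ∑ i, w i * χ (φ i j) = 0) {c : R} (hc : c ∈ cokerAnn φ) : χ c = 0 := by
  obtain ⟨i, hi⟩ := Function.ne_iff.1 hw
  obtain ⟨b, hb⟩ := mem_cokerAnn.1 hc (Pi.single i 1)
  have key : w i * χ c = 0 := by
    calc w i * χ c = ∑ k, w k * χ ((c • (Pi.single i 1 : Fin m → R)) k) := by
          rw [Finset.sum_eq_single i]
          · simp
          · intro k _ hk; simp [hk]
          · simp
      _ = ∑ k, w k * χ (φ.mulVec b k) := by rw [hb]
      _ = ∑ j, (∑ k, w k * χ (φ k j)) * χ (b j) := by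
          simp only [Matrix.mulVec, dotProduct, map_sum, map_mul, Finset.mul_sum, Finset.sum_mul]
          rw [Finset.sum_comm]
          refine Finset.sum_congr rfl fun _ _ => Finset.sum_congr rfl fun _ _ => by ring
      _ = 0 := by simp [hφ]
  exact (mul_eq_zero.1 key).resolve_left hi

/-- If a finitely generated quotient `G ⧸ U` is supported at a prime `Q`, there is a nonzero
functional on `G` with values in the residue field at `Q` that vanishes on `U`. -/
theorem exists_functional_of_annihilator_le {G : Type*} [AddCommGroup G] [Module R G]
    [Module.Finite R G] (U : Submodule R G) (Q : Ideal R) [Q.IsPrime]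
    (h : Module.annihilator R (G ⧸ U) ≤ Q) :
    ∃ f : G →ₗ[R] Q.ResidueField, f ≠ 0 ∧ ∀ x ∈ U, f x = 0 := by
  have h1 : (⟨Q, inferInstance⟩ : PrimeSpectrum R) ∈ Module.support R (G ⧸ U) :=
    Module.mem_support_iff_of_finite.2 h
  rw [Module.mem_support_iff_nontrivial_residueField_tensorProduct] at h1
  obtain ⟨t, ht⟩ := exists_ne (0 : Q.ResidueField ⊗[R] (G ⧸ U))
  obtain ⟨g, hg⟩ : ∃ g : Module.Dual Q.ResidueField (Q.ResidueField ⊗[R] (G ⧸ U)), g t ≠ 0 := by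
    by_contra! hc
    exact ht ((Module.forall_dual_apply_eq_zero_iff _ _).1 hc)
  let f : (G ⧸ U) →ₗ[R] Q.ResidueField :=
    (g.restrictScalars R) ∘ₗ TensorProduct.mk R Q.ResidueField (G ⧸ U) 1
  refine ⟨f ∘ₗ U.mkQ, fun h0 => hg ?_, fun x hx => ?_⟩
  · have hf : ∀ y, g (1 ⊗ₜ y) = 0 := by
      intro y
      obtain ⟨x, rfl⟩ := U.mkQ_surjective y
      exact congr($h0 x)
    induction t using TensorProduct.induction_on with
    | zero => simp
    | tmul a y =>
      have : a ⊗ₜ[R] y = a • ((1 : Q.ResidueField) ⊗ₜ[R] y) := by simp [TensorProduct.smul_tmul']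
      rw [this, map_smul, hf, smul_zero]
    | add x y hx hy =>
      rw [map_add]
      by_cases h1 : x = 0
      · by_cases h2 : y = 0
        · simp [h1, h2]
        · rw [h1, map_zero, zero_add]; by_contra h; exact h (hy h2 h)
      · by_cases h2 : y = 0
        · rw [h2, map_zero, add_zero]; by_contra h; exact h (hx h1 h)
        · have e1 : g x = 0 := by by_contra h; exact h (hx h1 h)
          have e2 : g y = 0 := by by_contra h; exact h (hy h2 h)
          rw [e1, e2, add_zero]
  · have : U.mkQ x = 0 := by simpa using hx
    simp [this]

/-- A prime contains the annihilator of the cokernel iff the matrix has dependent rows over the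
residue field. -/
theorem cokerAnn_le_iff {φ : Matrix (Fin m) (Fin n) R} {Q : Ideal R} [Q.IsPrime] :
    cokerAnn φ ≤ Q ↔ ∃ w : Fin m → Q.ResidueField, w ≠ 0 ∧
      ∀ j, ∑ i, w i * algebraMap R Q.ResidueField (φ i j) = 0 := by
  constructor
  · intro h
    obtain ⟨f, hf, hU⟩ := exists_functional_of_annihilator_le _ Q h
    refine ⟨fun i => f (Pi.single i 1), fun h0 => hf ?_, fun j => ?_⟩
    · ext i
      simpa using congr($h0 i)
    · have := hU (φ.mulVecLin (Pi.single j 1)) ⟨_, rfl⟩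
      rw [pi_eq_sum_univ' (φ.mulVecLin (Pi.single j 1)), map_sum] at this
      rw [← this]
      refine Finset.sum_congr rfl fun i _ => ?_
      rw [map_smul, Algebra.smul_def, mul_comm]
      simp
  · rintro ⟨w, hw, hφ⟩ c hc
    exact Ideal.algebraMap_residueField_eq_zero.1 (map_eq_zero_of_mem_cokerAnn _ hw hφ hc)

/-- The fraction-free Schur complement of a matrix with respect to the pivot `(p, q)`. -/
def schur (φ : Matrix (Fin (m + 1)) (Fin (n + 1)) R) (p : Fin (m + 1)) (q : Fin (n + 1)) :
    Matrix (Fin m) (Fin n) R :=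
  Matrix.of fun i j => φ p q * φ (p.succAbove i) (q.succAbove j) -
    φ (p.succAbove i) q * φ p (q.succAbove j)

/-- Where the pivot is invertible, elimination turns row dependencies of the matrix into those of
the smaller one and back, so no localization is needed. -/
theorem cokerAnn_schur_le_iff {φ : Matrix (Fin (m + 1)) (Fin (n + 1)) R} {p : Fin (m + 1)}
    {q : Fin (n + 1)} {Q : Ideal R} [Q.IsPrime] (hQ : φ p q ∉ Q) :
    cokerAnn (schur φ p q) ≤ Q ↔ cokerAnn φ ≤ Q := by
  rw [cokerAnn_le_iff, cokerAnn_le_iff]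
  set χ := algebraMap R Q.ResidueField
  have hu : χ (φ p q) ≠ 0 := by rwa [Ne, Ideal.algebraMap_residueField_eq_zero]
  constructor
  · rintro ⟨w, hw, hφ⟩
    -- The given dependency is scaled by the pivot; its coordinate at `p` is then forced by column
    -- `q`.
    set w' : Fin (m + 1) → Q.ResidueField := p.insertNth
      (-∑ i, w i * χ (φ (p.succAbove i) q)) (fun i => χ (φ p q) * w i) with hw'
    have e1 : w' p = -∑ i, w i * χ (φ (p.succAbove i) q) := by simp [hw']
    have e2 : ∀ i, w' (p.succAbove i) = χ (φ p q) * w i := by simp [hw']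
    refine ⟨w', fun h0 => hw ?_, fun j => ?_⟩
    · ext i
      have := e2 i
      rw [h0] at this
      simpa [hu] using this
    · rw [Fin.sum_univ_succAbove _ p, e1]
      simp only [e2]
      obtain rfl | ⟨j, rfl⟩ := q.eq_self_or_eq_succAbove j
      · rw [neg_mul, Finset.sum_mul, neg_add_eq_zero]
        refine Finset.sum_congr rfl fun i _ => by ring
      · rw [neg_mul, Finset.sum_mul, ← sub_eq_neg_add, ← Finset.sum_sub_distrib, ← hφ j]
        refine Finset.sum_congr rfl fun i _ => ?_
        simp only [schur, Matrix.of_apply, map_sub, map_mul]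
        ring
  · rintro ⟨w, hw, hφ⟩
    have hq := hφ q
    rw [Fin.sum_univ_succAbove _ p] at hq
    refine ⟨fun i => w (p.succAbove i), fun h0 => hw ?_, fun j => ?_⟩
    · have h0' : ∀ i, w (p.succAbove i) = 0 := fun i => congr($h0 i)
      simp only [h0', zero_mul, Finset.sum_const_zero, add_zero, mul_eq_zero, hu, or_false] at hq
      ext i
      obtain rfl | ⟨i, rfl⟩ := p.eq_self_or_eq_succAbove i
      · exact hq
      · exact h0' i
    · have hj := hφ (q.succAbove j)
      rw [Fin.sum_univ_succAbove _ p] at hj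
      have : ∑ i, w (p.succAbove i) * χ (schur φ p q i j) =
          χ (φ p q) * (∑ i, w (p.succAbove i) * χ (φ (p.succAbove i) (q.succAbove j))) -
          (∑ i, w (p.succAbove i) * χ (φ (p.succAbove i) q)) * χ (φ p (q.succAbove j)) := by
        rw [Finset.mul_sum, Finset.sum_mul, ← Finset.sum_sub_distrib]
        refine Finset.sum_congr rfl fun i _ => ?_
        simp only [schur, Matrix.of_apply, map_sub, map_mul]
        ring
      rw [this]
      linear_combination χ (φ p q) * hj - χ (φ p (q.succAbove j)) * hq

theorem mem_minimalPrimes_cokerAnn_schur {φ : Matrix (Fin (m + 1)) (Fin (n + 1)) R}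
    {p : Fin (m + 1)} {q : Fin (n + 1)} {P : Ideal R} (hP : P ∈ (cokerAnn φ).minimalPrimes)
    (hpq : φ p q ∉ P) : P ∈ (cokerAnn (schur φ p q)).minimalPrimes := by
  have := hP.1.1
  refine ⟨⟨hP.1.1, (cokerAnn_schur_le_iff hpq).2 hP.1.2⟩, fun Q hQ hQP => ?_⟩
  have := hQ.1
  exact hP.2 ⟨hQ.1, (cokerAnn_schur_le_iff (fun h => hpq (hQP h))).1 hQ.2⟩ hQP

end Degeneracy

/-! ### Adding an indeterminate, and the height bound for `m × (m + 1)` matrices -/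

section Shift

open Polynomial

variable {R : Type*} [CommRing R] {m n : ℕ}

theorem height_le_height_map_C (P : Ideal R) [P.IsPrime] :
    P.height ≤ (P.map (C : R →+* R[X])).height := by
  have hp : (P.map (C : R →+* R[X])).IsPrime := Ideal.isPrime_map_C_of_isPrime
  let f : PrimeSpectrum R → PrimeSpectrum R[X] := fun q =>
    ⟨q.asIdeal.map C, Ideal.isPrime_map_C_of_isPrime⟩
  have hf : StrictMono f := by
    refine Monotone.strictMono_of_injective (fun a b h => Ideal.map_mono h) fun a b h => ?_
    have h' : a.asIdeal.map (C : R →+* R[X]) = b.asIdeal.map C := congr($(h).asIdeal)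
    ext x
    have hC : ∀ J : Ideal R, C x ∈ J.map (C : R →+* R[X]) ↔ x ∈ J := fun J => by
      rw [Ideal.mem_map_C_iff]
      refine ⟨fun h => by simpa using h 0, fun h n => ?_⟩
      rw [coeff_C]
      split_ifs <;> simp [h]
    rw [← hC, h', hC]
  have := Order.height_le_height_apply_of_strictMono f hf ⟨P, inferInstance⟩
  rwa [← PrimeSpectrum.height_eq_orderHeight, ← PrimeSpectrum.height_eq_orderHeight] at this

/-- The matrix over `R[X]` obtained by adding the indeterminate to the top left entry. -/
noncomputable def shift (φ : Matrix (Fin (m + 1)) (Fin (n + 1)) R) :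
    Matrix (Fin (m + 1)) (Fin (n + 1)) R[X] :=
  Matrix.of fun i j => C (φ i j) + if i = 0 ∧ j = 0 then X else 0

/-- This creates a pivot when all entries lie in `P`. The second row of the shifted matrix still
vanishes modulo `PR[X]`, which is why two rows are required. For minimality, setting `X = 0`
recovers `φ`, so `P + (X)` is minimal over `Q + (X)` for any competing prime `Q`. Krull's principal
ideal theorem in `R[X]/Q` then forbids a chain `Q < PR[X] < P + (X)`. -/
theorem map_C_mem_minimalPrimes_shift [IsNoetherianRing R]
    {φ : Matrix (Fin (m + 2)) (Fin (n + 1)) R} {P : Ideal R} (hP : P ∈ (cokerAnn φ).minimalPrimes)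
    (hφ : ∀ i j, φ i j ∈ P) : P.map C ∈ (cokerAnn (shift φ)).minimalPrimes := by
  have hPp := hP.1.1
  have hp : (P.map (C : R →+* R[X])).IsPrime := Ideal.isPrime_map_C_of_isPrime
  refine ⟨⟨hp, cokerAnn_le_iff.2 ⟨Pi.single 1 1, by simp, fun j => ?_⟩⟩, fun Q hQ hQP => ?_⟩
  · rw [Finset.sum_eq_single 1]
    · simp only [Pi.single_eq_same, one_mul, shift, Matrix.of_apply]
      rw [if_neg (by simp), add_zero, Ideal.algebraMap_residueField_eq_zero]
      exact Ideal.mem_map_of_mem _ (hφ _ _)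
    · intro i _ hi; simp [hi]
    · simp
  · have hQp := hQ.1
    -- This is the prime `P + (X)`.
    set P₁ : Ideal R[X] := P.comap (constantCoeff : R[X] →+* R) with hP₁
    have hPP₁ : P.map C ≤ P₁ := by
      rw [Ideal.map_le_iff_le_comap]
      intro x hx
      simpa [hP₁] using hx
    have hX : (X : R[X]) ∈ P₁ := by simp [hP₁]
    have hXP : (X : R[X]) ∉ P.map C := by
      intro h
      have := (Ideal.mem_map_C_iff.1 h) 1
      rw [coeff_X_one] at this
      exact hPp.ne_top ((Ideal.eq_top_iff_one _).2 this)
    have hlt : P.map C < P₁ := lt_of_le_of_ne hPP₁ fun h => hXP (h ▸ hX)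
    have hmin : P₁ ∈ (Q ⊔ Ideal.span {X}).minimalPrimes := by
      refine ⟨⟨inferInstance, sup_le (hQP.trans hPP₁) (by simpa [Ideal.span_le] using hX)⟩,
        fun Q₁ hQ₁ hle => ?_⟩
      have hQ₁p := hQ₁.1
      have hX₁ : X ∈ Q₁ := hQ₁.2 (le_sup_right (a := Q) (Ideal.mem_span_singleton_self X))
      have hq : cokerAnn φ ≤ Q₁.comap C := by
        intro c hc
        obtain ⟨w, hw, hwφ⟩ := cokerAnn_le_iff.1 (hQ.2.trans (le_sup_left.trans hQ₁.2))
        have hXz : algebraMap R[X] Q₁.ResidueField X = 0 :=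
          Ideal.algebraMap_residueField_eq_zero.2 hX₁
        set χ : R →+* Q₁.ResidueField := (algebraMap R[X] Q₁.ResidueField).comp C with hχ
        have hwφ' : ∀ j, ∑ i, w i * χ (φ i j) = 0 := by
          intro j
          rw [← hwφ j]
          refine Finset.sum_congr rfl fun i _ => ?_
          simp only [shift, Matrix.of_apply, map_add, hχ, RingHom.comp_apply]
          split_ifs <;> simp [hXz]
        have := map_eq_zero_of_mem_cokerAnn χ hw hwφ' hc
        rw [hχ, RingHom.comp_apply, Ideal.algebraMap_residueField_eq_zero] at this
        exact this
      have hqP : Q₁.comap C ≤ P := by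
        intro x hx
        have := hle hx
        simpa [hP₁] using this
      have hPq : P ≤ Q₁.comap C := hP.2 ⟨inferInstance, hq⟩ hqP
      intro f hf
      have hf0 : f.coeff 0 ∈ P := hf
      rw [← Polynomial.divX_mul_X_add f]
      exact add_mem (Ideal.mul_mem_left _ _ hX₁) (hPq hf0)
    by_contra hne
    have hlt' : Q < P.map C := lt_of_le_of_ne hQP fun h => hne h.ge
    set π := Ideal.Quotient.mk Q
    have h1 : (P₁.map π).height ≤ 1 := Ideal.map_height_le_one_of_mem_minimalPrimes hmin
    have hp1 : (P₁.map π).IsPrime := Ideal.isPrime_map_quotientMk_of_isPrime (hQP.trans hPP₁)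
    have hp2 : ((P.map C).map π).IsPrime := Ideal.isPrime_map_quotientMk_of_isPrime hQP
    have comap_map : ∀ J : Ideal R[X], Q ≤ J → (J.map π).comap π = J :=
      fun J hJ => Ideal.comap_map_mk hJ
    have l1 : (P.map C).map π < P₁.map π := lt_of_le_of_ne (Ideal.map_mono hPP₁) fun h => by
      have := congrArg (Ideal.comap π) h
      rw [comap_map _ hQP, comap_map _ (hQP.trans hPP₁)] at this
      exact hlt.ne this
    have l2 : (⊥ : Ideal (R[X] ⧸ Q)) < (P.map C).map π := bot_lt_iff_ne_bot.2 fun h => by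
      have := congrArg (Ideal.comap π) h
      rw [comap_map _ hQP, ← RingHom.ker_eq_comap_bot, Ideal.mk_ker] at this
      exact hlt'.ne this.symm
    have : (⊥ : Ideal (R[X] ⧸ Q)).IsPrime := Ideal.isPrime_bot
    have a1 := Ideal.height_add_one_le_of_lt_of_isPrime l1
    have a2 := Ideal.height_add_one_le_of_lt_of_isPrime l2
    have a3 : (1 : ℕ∞) + 1 ≤ 1 :=
      ((add_le_add_left (le_add_self.trans a2) 1).trans a1).trans h1
    exact absurd a3 (by decide)

/-- A minimal prime of the annihilator of the cokernel of a matrix with one more column than rows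
has height at most two. -/
theorem height_le_two_of_mem_minimalPrimes_cokerAnn (m : ℕ) {R : Type*} [CommRing R]
    [IsNoetherianRing R] (φ : Matrix (Fin m) (Fin (m + 1)) R) {P : Ideal R}
    (hP : P ∈ (cokerAnn φ).minimalPrimes) : P.height ≤ 2 := by
  induction m generalizing R with
  | zero =>
    have := hP.1.1
    obtain ⟨w, hw, -⟩ := cokerAnn_le_iff.1 hP.1.2
    exact absurd (Subsingleton.elim w 0) hw
  | succ m ih =>
    have hPp := hP.1.1
    by_cases h : ∃ i j, φ i j ∉ P
    · obtain ⟨i, j, hij⟩ := h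
      exact ih _ (mem_minimalPrimes_cokerAnn_schur hP hij)
    · push Not at h
      cases m with
      | zero =>
        -- A single row has two entries, and it degenerates exactly where both vanish, so Krull's
        -- height theorem applies.
        have key : ∀ Q : Ideal R, Q.IsPrime → (cokerAnn φ ≤ Q ↔ Ideal.span (Set.range (φ 0)) ≤ Q) := by
          intro Q hQ
          rw [cokerAnn_le_iff, Ideal.span_le]
          simp only [Fin.sum_univ_succ, Finset.univ_eq_empty, Finset.sum_empty, add_zero]
          constructor
          · rintro ⟨w, hw, hφ⟩ _ ⟨j, rfl⟩
            have hw0 : w 0 ≠ 0 := fun h => hw (by ext i; fin_cases i; exact h)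
            have := (mul_eq_zero.1 (hφ j)).resolve_left hw0
            exact Ideal.algebraMap_residueField_eq_zero.1 this
          · intro hφ
            refine ⟨1, one_ne_zero, fun j => ?_⟩
            simpa using hφ ⟨j, rfl⟩
        have hP' : P ∈ (Ideal.span (Set.range (φ 0))).minimalPrimes :=
          ⟨⟨hPp, (key P hPp).1 hP.1.2⟩, fun Q hQ hQP => hP.2 ⟨hQ.1, (key Q hQ.1).2 hQ.2⟩ hQP⟩
        refine (Ideal.height_le_card_of_mem_minimalPrimes_span (Set.finite_range _) hP').trans ?_
        have : (Set.range (φ 0)).ncard ≤ 2 := by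
          rw [← Set.image_univ]
          exact (Set.ncard_image_le Set.finite_univ).trans (by simp)
        exact_mod_cast this
      | succ m =>
        have hmin := map_C_mem_minimalPrimes_shift hP h
        -- The corner entry has `X`-coefficient `1`, so it is a pivot and the Schur complement
        -- lowers the size.
        have hpiv : shift φ 0 0 ∉ P.map C := by
          intro hmem
          have := (Ideal.mem_map_C_iff.1 hmem) 1
          simp [shift] at this
          exact hPp.ne_top ((Ideal.eq_top_iff_one _).2 this)
        exact (height_le_height_map_C P).trans (ih _ (mem_minimalPrimes_cokerAnn_schur hmin hpiv))

end Shift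

/-! ### Fitting ideals and supports of ideal modules -/

section IdealModule

variable {R : Type*} [CommRing R]

theorem exists_fin_span_eq {M : Type*} [AddCommGroup M] [Module R M] {T : Finset M} {e : ℕ}
    (h : T.card ≤ e) :
    ∃ y : Fin e → M, Submodule.span R (Set.range y) = Submodule.span R (T : Set M) := by
  refine ⟨fun i => if h : i.1 < T.card then (T.equivFin.symm ⟨i, h⟩ : M) else 0,
    le_antisymm ?_ ?_⟩
  · rw [Submodule.span_le]
    rintro _ ⟨i, rfl⟩
    dsimp only
    split_ifs with hi
    · exact Submodule.subset_span (T.equivFin.symm ⟨i, hi⟩).2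
    · exact zero_mem _
  · refine Submodule.span_mono fun x hx => ?_
    refine ⟨Fin.castLE h (T.equivFin ⟨x, hx⟩), ?_⟩
    simp

theorem exists_fin_span_eq_top_of_spanFinrank_le {M : Type*} [AddCommGroup M] [Module R M]
    [Module.Finite R M] {e : ℕ} (h : (⊤ : Submodule R M).spanFinrank ≤ e) :
    ∃ y : Fin e → M, Submodule.span R (Set.range y) = ⊤ := by
  obtain ⟨T, hT, hT'⟩ :=
    (Module.Finite.fg_top (R := R) (M := M)).exists_span_finset_card_eq_spanFinrank
  obtain ⟨y, hy⟩ := exists_fin_span_eq (R := R) (hT.trans_le h)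
  exact ⟨y, hy.trans hT'⟩

theorem spanFinrank_top_le_of_span_range_eq_top {M : Type*} [AddCommGroup M] [Module R M]
    {e : ℕ} {y : Fin e → M} (hy : Submodule.span R (Set.range y) = ⊤) :
    (⊤ : Submodule R M).spanFinrank ≤ e := by
  rw [← hy]
  refine (Submodule.spanFinrank_span_le_ncard_of_finite (Set.finite_range y)).trans ?_
  rw [← Set.image_univ]
  exact (Set.ncard_image_le Set.finite_univ).trans (by simp)

variable {G : Type*} [AddCommGroup G] [Module R G] {e : ℕ} {E : Submodule R G}

theorem mem_annihilator_quotient {c : R} :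
    c ∈ Module.annihilator R (G ⧸ E) ↔ ∀ g : G, c • g ∈ E := by
  rw [Module.mem_annihilator]
  refine ⟨fun h g => ?_, fun h x => ?_⟩
  · have := h (Submodule.Quotient.mk g)
    rwa [← Submodule.Quotient.mk_smul, Submodule.Quotient.mk_eq_zero] at this
  · obtain ⟨g, rfl⟩ := Submodule.Quotient.mk_surjective _ x
    rw [← Submodule.Quotient.mk_smul, Submodule.Quotient.mk_eq_zero]
    exact h g

/-- An ideal module that is generated by `e` elements locally at a prime `P` is equal to the
ambient free module at `P`. -/
theorem IsIdealModule.not_annihilator_le [IsNoetherianRing R] (hE : IsIdealModule e E)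
    {P : Ideal R} [P.IsPrime] {d : R} (hd : d ∉ P) (y : Fin e → G) (hyE : ∀ i, y i ∈ E)
    (hy : ∀ x ∈ E, d • x ∈ Submodule.span R (Set.range y)) :
    ¬ Module.annihilator R (G ⧸ E) ≤ P := by
  intro hle
  obtain ⟨⟨L⟩, hgr⟩ := hE
  set ψ : Matrix (Fin e) (Fin e) R := Matrix.of fun i => L (y i) with hψ
  have hcomb : ∀ a : Fin e → R, L (∑ i, a i • y i) = Matrix.vecMul a ψ := by
    intro a
    ext j
    simp [hψ, Matrix.vecMul, dotProduct]
  -- By Cramer's rule the determinant multiplies `G` into the span of the `y i`.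
  have hδ : ψ.det ∈ P := by
    refine hle (mem_annihilator_quotient.2 fun g => ?_)
    have : ψ.det • g = ∑ i, (Matrix.vecMul (L g) ψ.adjugate) i • y i := by
      apply L.injective
      rw [hcomb, Matrix.vecMul_vecMul, Matrix.adjugate_mul, map_smul, Matrix.vecMul_smul,
        Matrix.vecMul_one]
    rw [this]
    exact Submodule.sum_mem _ fun i _ => Submodule.smul_mem _ _ (hyE i)
  obtain ⟨Q, hQ, hQP⟩ := Ideal.exists_minimalPrimes_le
    ((Ideal.span_singleton_le_iff_mem P).2 hδ)
  have hQp := hQ.1.1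
  have h1 : Q.height ≤ 1 := Ideal.height_le_one_of_isPrincipal_of_mem_minimalPrimes _ Q hQ
  -- For `c` in the annihilator, `dc` multiplies the standard basis into the span of the `y i`.
  -- Taking determinants, `(dc) ^ e` is a multiple of `det ψ`, so it lies in `Q`. The annihilator
  -- would thus have height at most one.
  have hAQ : Module.annihilator R (G ⧸ E) ≤ Q := by
    intro c hc
    have hex : ∀ i, ∃ a : Fin e → R, Matrix.vecMul a ψ = (d * c) • Pi.single i 1 := by
      intro i
      have := hy _ (mem_annihilator_quotient.1 hc (L.symm (Pi.single i 1)))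
      obtain ⟨a, ha⟩ := (Submodule.mem_span_range_iff_exists_fun R).1 this
      refine ⟨a, ?_⟩
      rw [← hcomb, ha, map_smul, map_smul, L.apply_symm_apply, smul_smul]
    choose B hB using hex
    have hBψ : Matrix.of B * ψ = (d * c) • (1 : Matrix (Fin e) (Fin e) R) := by
      ext i j
      have := congr($(hB i) j)
      rw [Matrix.mul_apply]
      simpa [Matrix.vecMul, dotProduct, Matrix.one_apply, Pi.single_apply, eq_comm] using this
    have hdet := congrArg Matrix.det hBψ
    rw [Matrix.det_mul, Matrix.det_smul, Matrix.det_one, mul_one] at hdet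
    have : (d * c) ^ Fintype.card (Fin e) ∈ Q := by
      rw [← hdet]
      exact Ideal.mul_mem_left _ _ (hQ.1.2 (Ideal.mem_span_singleton_self _))
    exact (hQp.mem_or_mem (hQp.mem_of_pow_mem _ this)).resolve_left fun h => hd (hQP h)
  have h2 : (2 : ℕ∞) ≤ 1 :=
    (hgr.trans (idealGrade_le_height _)).trans ((Ideal.height_mono hAQ).trans h1)
  exact absurd h2 (by decide)

theorem IsIdealModule.span_ne_top [IsNoetherianRing R] (hE : IsIdealModule e E) (hEG : E < ⊤)
    (y : Fin e → E) : Submodule.span R (Set.range y) ≠ ⊤ := by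
  intro hy
  have hA : Module.annihilator R (G ⧸ E) ≠ ⊤ := fun h => hEG.ne <| by
    rw [eq_top_iff]
    intro g _
    simpa using mem_annihilator_quotient.1 ((Ideal.eq_top_iff_one _).1 h) g
  obtain ⟨P, hP, hle⟩ := Ideal.exists_le_maximal _ hA
  have := hP.isPrime
  refine hE.not_annihilator_le (P := P) (d := 1) (fun h => this.ne_top
    ((Ideal.eq_top_iff_one _).2 h)) (fun i => y i) (fun i => (y i).2) (fun x hx => ?_) hle
  have h1 : (⟨x, hx⟩ : E) ∈ Submodule.span R (Set.range y) := by rw [hy]; trivial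
  have h2 := Submodule.mem_map_of_mem (f := E.subtype) h1
  rw [Submodule.map_span, ← Set.range_comp] at h2
  simpa [Function.comp_def] using h2

theorem det_smul_eq_zero_of_sum_smul_eq_zero {M : Type*} [AddCommGroup M] [Module R M] {k : ℕ}
    (N : Matrix (Fin k) (Fin k) R) (v : Fin k → M) (h : ∀ i, ∑ j, N i j • v j = 0) (l : Fin k) :
    N.det • v l = 0 := by
  have : ∑ i, N.adjugate l i • ∑ j, N i j • v j = N.det • v l := by
    simp_rw [Finset.smul_sum, smul_smul]
    rw [Finset.sum_comm]
    simp_rw [← Finset.sum_smul, ← Matrix.mul_apply, Matrix.adjugate_mul]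
    simp [Matrix.one_apply]
  rw [← this]
  simp [h]

theorem det_mem_fittingIdeal {M : Type*} [AddCommGroup M] [Module R M] {n i k : ℕ}
    (h : n - i = k) (x : Fin n → M) (hx : Submodule.span R (Set.range x) = ⊤)
    (ρ : Fin k → Fin n → R) (s : Fin k → Fin n) (hρ : ∀ k, ∑ j, ρ k j • x j = 0) :
    (Matrix.of fun k l => ρ k (s l)).det ∈ fittingIdeal R M i := by
  subst h
  exact Ideal.subset_span ⟨n, x, hx, ρ, s, hρ, rfl⟩

/-- A minor of the relations that does not vanish at `P` shows that the module is generated by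
`i` elements locally at `P`. -/
theorem exists_smul_mem_span_of_not_fittingIdeal_le {M : Type*} [AddCommGroup M] [Module R M]
    {i : ℕ} {P : Ideal R} (h : ¬ fittingIdeal R M i ≤ P) :
    ∃ d ∉ P, ∃ y : Fin i → M, ∀ x, d • x ∈ Submodule.span R (Set.range y) := by
  rw [fittingIdeal, Ideal.span_le, Set.not_subset] at h
  obtain ⟨_, ⟨n, x, hx, ρ, s, hρ, rfl⟩, hd⟩ := h
  classical
  set N : Matrix (Fin (n - i)) (Fin (n - i)) R := Matrix.of fun k l => ρ k (s l) with hN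
  have hs : Function.Injective s := by
    intro a b hab
    by_contra hne
    refine hd ?_
    rw [Matrix.det_zero_of_column_eq hne (fun k => by simp [hN, hab])]
    exact P.zero_mem
  set T : Finset M := (Finset.univ \ Finset.univ.image s).image x with hT
  -- For `n < i` the truncated difference `n - i` is `0`: the minor is empty and `T` consists of all
  -- generators.
  have hcard : T.card ≤ i := by
    refine Finset.card_image_le.trans ?_
    rw [Finset.card_sdiff_of_subset (Finset.subset_univ _), Finset.card_image_of_injective _ hs]
    simp only [Finset.card_univ, Fintype.card_fin]
    omega
  obtain ⟨y, hy⟩ := exists_fin_span_eq (R := R) hcard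
  refine ⟨_, hd, y, fun z => ?_⟩
  rw [hy]
  have hxT : ∀ j, (∀ l, s l ≠ j) → x j ∈ Submodule.span R (T : Set M) := by
    intro j hj
    refine Submodule.subset_span ?_
    simp only [hT, Finset.coe_image]
    exact ⟨j, by simpa using hj, rfl⟩
  have hxs : ∀ l, N.det • x (s l) ∈ Submodule.span R (T : Set M) := by
    intro l
    rw [← Submodule.Quotient.mk_eq_zero, Submodule.Quotient.mk_smul]
    refine det_smul_eq_zero_of_sum_smul_eq_zero N
      (fun l => Submodule.Quotient.mk (p := Submodule.span R (T : Set M)) (x (s l)))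
      (fun k => ?_) l
    have h0 := congrArg (Submodule.mkQ (Submodule.span R (T : Set M))) (hρ k)
    rw [map_sum, map_zero, ← Finset.sum_subset (Finset.subset_univ (Finset.univ.image s)),
      Finset.sum_image (fun a _ b _ hab => hs hab)] at h0
    · simpa [hN] using h0
    · intro j _ hj
      rw [map_smul, Submodule.mkQ_apply, (Submodule.Quotient.mk_eq_zero _).2, smul_zero]
      exact hxT j fun l hl => hj (by simp [← hl])
  have hz : z ∈ Submodule.span R (Set.range x) := by rw [hx]; trivial
  induction hz using Submodule.span_induction with
  | mem z hz =>
    obtain ⟨j, rfl⟩ := hz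
    by_cases hj : ∃ l, s l = j
    · obtain ⟨l, rfl⟩ := hj
      exact hxs l
    · push Not at hj
      exact Submodule.smul_mem _ _ (hxT j hj)
  | zero => simp
  | add a b _ _ ha hb => rw [smul_add]; exact add_mem ha hb
  | smul r a _ ha => rw [smul_comm]; exact Submodule.smul_mem _ _ ha

/-- For `c` in the annihilator, enlarge a generating family `y` of `E`, with `m` members, by the `e`
vectors `c • e_i`. Expanding `c • y k` in coordinates of `G` gives `m` relations whose block on the
`y` is `c` times the identity, so `c ^ m` is one of the minors. -/
theorem IsIdealModule.annihilator_le_radical_fittingIdeal [IsNoetherianRing R]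
    (hE : IsIdealModule e E) :
    Module.annihilator R (G ⧸ E) ≤ (fittingIdeal R E e).radical := by
  intro c hc
  obtain ⟨⟨L⟩, -⟩ := hE
  have : Module.Finite R G := Module.Finite.equiv L.symm
  rw [mem_annihilator_quotient] at hc
  obtain ⟨m, y, hy⟩ := Module.Finite.exists_fin (R := R) (M := E)
  set g : Fin e → E := fun i => ⟨c • L.symm (Pi.single i 1), hc _⟩ with hg
  have hx : Submodule.span R (Set.range (Fin.append g y)) = ⊤ := by
    rw [eq_top_iff, ← hy]
    refine Submodule.span_mono ?_
    rintro _ ⟨i, rfl⟩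
    exact ⟨Fin.natAdd e i, by simp⟩
  have := det_mem_fittingIdeal (k := m) (i := e) (by omega) (Fin.append g y) hx
    (fun k => Fin.append (fun i => -(L (y k) i)) (c • Pi.single k 1)) (Fin.natAdd e) (by
      intro k
      rw [Fin.sum_univ_add]
      simp only [Fin.append_left, Fin.append_right]
      rw [Finset.sum_eq_single k (fun l _ hl => by simp [hl]) (by simp)]
      ext
      apply L.injective
      ext j
      simp [hg, Pi.single_apply, mul_comm])
  have hdet : (Matrix.of fun (k l : Fin m) =>
      (Fin.append (fun i => -(L (y k) i)) (c • Pi.single k 1 : Fin m → R)) (Fin.natAdd e l)) =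
      c • (1 : Matrix (Fin m) (Fin m) R) := by
    ext k l
    simp [Matrix.one_apply, Pi.single_apply, eq_comm]
  rw [hdet, Matrix.det_smul, Matrix.det_one, mul_one, Fintype.card_fin] at this
  exact ⟨m, this⟩

/-- The Fitting ideal `F_e` of an ideal module defines the support of `G ⧸ E`. -/
theorem IsIdealModule.fittingIdeal_le_iff [IsNoetherianRing R] (hE : IsIdealModule e E)
    (P : Ideal R) [P.IsPrime] :
    fittingIdeal R E e ≤ P ↔ Module.annihilator R (G ⧸ E) ≤ P := by
  constructor
  · intro h
    exact hE.annihilator_le_radical_fittingIdeal.trans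
      ((Ideal.radical_mono h).trans (Ideal.IsPrime.radical inferInstance).le)
  · contrapose
    intro h
    obtain ⟨d, hd, y, hy⟩ := exists_smul_mem_span_of_not_fittingIdeal_le h
    refine hE.not_annihilator_le hd (fun i => (y i : G)) (fun i => (y i).2) fun x hx => ?_
    have h2 := Submodule.mem_map_of_mem (f := E.subtype) (hy ⟨x, hx⟩)
    rw [Submodule.map_span, ← Set.range_comp] at h2
    simpa [Function.comp_def] using h2

theorem IsIdealModule.height_fittingIdeal [IsNoetherianRing R] (hE : IsIdealModule e E) :
    (fittingIdeal R E e).height = (Module.annihilator R (G ⧸ E)).height := by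
  have : (fittingIdeal R E e).minimalPrimes = (Module.annihilator R (G ⧸ E)).minimalPrimes := by
    ext P
    constructor
    · rintro ⟨⟨hP, h1⟩, h2⟩
      exact ⟨⟨hP, (hE.fittingIdeal_le_iff P).1 h1⟩, fun Q hQ hQP => by
        have := hQ.1
        exact h2 ⟨hQ.1, (hE.fittingIdeal_le_iff Q).2 hQ.2⟩ hQP⟩
    · rintro ⟨⟨hP, h1⟩, h2⟩
      exact ⟨⟨hP, (hE.fittingIdeal_le_iff P).2 h1⟩, fun Q hQ hQP => by
        have := hQ.1
        exact h2 ⟨hQ.1, (hE.fittingIdeal_le_iff Q).1 hQ.2⟩ hQP⟩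
  rw [Ideal.height_eq_inf_minimalPrimes, this, ← Ideal.height_eq_inf_minimalPrimes]

theorem IsIdealModule.two_le_idealGrade_fittingIdeal [IsNoetherianRing R]
    (hE : IsIdealModule e E) : 2 ≤ idealGrade (fittingIdeal R E e) :=
  two_le_idealGrade_of_le_radical hE.annihilator_le_radical_fittingIdeal hE.2

/-- If every functional with values in a residue field that vanishes on `U = ⟨u_0, …, u_e⟩` also
vanishes on `E`, then the annihilator of `G ⧸ E` has height at most two. -/
theorem IsIdealModule.height_annihilator_le_two [IsNoetherianRing R] (hE : IsIdealModule e E)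
    (hEG : E < ⊤) (u : Fin (e + 1) → E)
    (hu : ∀ (Q : Ideal R) [Q.IsPrime] (f : G →ₗ[R] Q.ResidueField),
      (∀ i, f (u i) = 0) → ∀ x ∈ E, f x = 0) :
    (Module.annihilator R (G ⧸ E)).height ≤ 2 := by
  obtain ⟨⟨L⟩, -⟩ := hE
  have hA : Module.annihilator R (G ⧸ E) ≠ ⊤ := fun h => hEG.ne <| by
    rw [eq_top_iff]
    intro g _
    simpa using mem_annihilator_quotient.1 ((Ideal.eq_top_iff_one _).1 h) g
  set φ : Matrix (Fin e) (Fin (e + 1)) R := Matrix.of fun i j => L (u j) i with hφ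
  -- Both annihilators lie in the same primes: a row dependency of `φ` at `Q` is a functional
  -- killing the `u j`, hence `E`; conversely the columns of `φ` come from elements of `E`.
  have key : ∀ Q : Ideal R, Q.IsPrime →
      (cokerAnn φ ≤ Q ↔ Module.annihilator R (G ⧸ E) ≤ Q) := by
    intro Q hQ
    constructor
    · intro h c hc
      obtain ⟨w, hw, hwφ⟩ := cokerAnn_le_iff.1 h
      let f₀ : (Fin e → R) →ₗ[R] Q.ResidueField :=
        Fintype.linearCombination R w
      have hf₀ : ∀ v, f₀ v = ∑ i, v i • w i := fun v => Fintype.linearCombination_apply R w v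
      have hf := hu Q (f₀ ∘ₗ L.toLinearMap) (fun j => by
        rw [LinearMap.comp_apply, hf₀, ← hwφ j]
        refine Finset.sum_congr rfl fun i _ => ?_
        rw [Algebra.smul_def, mul_comm]
        simp [hφ])
      obtain ⟨i, hi⟩ := Function.ne_iff.1 hw
      have := hf _ (mem_annihilator_quotient.1 hc (L.symm (Pi.single i 1)))
      rw [map_smul, LinearMap.comp_apply, hf₀, LinearEquiv.coe_coe, L.apply_symm_apply,
        Finset.sum_eq_single i (fun k _ hk => by simp [hk]) (by simp), Pi.single_eq_same, one_smul,
        Algebra.smul_def, mul_eq_zero] at this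
      exact Ideal.algebraMap_residueField_eq_zero.1 (this.resolve_right hi)
    · intro h c hc
      refine h (mem_annihilator_quotient.2 fun g => ?_)
      obtain ⟨b, hb⟩ := mem_cokerAnn.1 hc (L g)
      have : c • g = ∑ j, b j • (u j : G) := by
        apply L.injective
        rw [map_smul, ← hb]
        ext i
        simp [Matrix.mulVec, dotProduct, hφ, mul_comm]
      rw [this]
      exact Submodule.sum_mem _ fun j _ => Submodule.smul_mem _ _ (u j).2
  obtain ⟨P, hP⟩ := Ideal.nonempty_minimalPrimes hA
  have hP' : P ∈ (cokerAnn φ).minimalPrimes :=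
    ⟨⟨hP.1.1, (key P hP.1.1).2 hP.1.2⟩, fun Q hQ hQP => hP.2 ⟨hQ.1, (key Q hQ.1).1 hQ.2⟩ hQP⟩
  exact (Ideal.height_mono hP.1.2).trans (height_le_two_of_mem_minimalPrimes_cokerAnn e φ hP')

end IdealModule

/-! ### The Rees algebra, its grading, and reductions -/

section Rees

open Polynomial nonZeroDivisors

variable (R : Type*) [CommRing R] (M : Type*) [AddCommGroup M] [Module R M]

/-- The Rees algebra of a module, as a type of its own. -/
def Rees : Type _ := ReesAlg R M

noncomputable instance : CommRing (Rees R M) := inferInstanceAs (CommRing (ReesAlg R M))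

noncomputable instance : Algebra R (Rees R M) := inferInstanceAs (Algebra R (ReesAlg R M))

/-- The quotient map from the symmetric algebra to the Rees algebra. -/
noncomputable def reesMk : SymmetricAlgebra R M →ₐ[R] Rees R M :=
  Ideal.Quotient.mkₐ R (symTorsion R M)

/-- The canonical map from a module to its Rees algebra. -/
noncomputable def reesι : M →ₗ[R] Rees R M :=
  (reesMk R M).toLinearMap ∘ₗ SymmetricAlgebra.ι R M

/-- The degree one component of the Rees algebra. -/
noncomputable def reesGens : Submodule R (Rees R M) :=
  LinearMap.range (reesι R M)

variable {R M}

theorem reesMk_surjective : Function.Surjective (reesMk R M) :=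
  Ideal.Quotient.mk_surjective

theorem reesMk_eq_zero_iff {s : SymmetricAlgebra R M} : reesMk R M s = 0 ↔ s ∈ symTorsion R M :=
  Ideal.Quotient.eq_zero_iff_mem

theorem reesι_mem_reesGens (x : M) : reesι R M x ∈ reesGens R M :=
  ⟨x, rfl⟩

theorem reesGens_fg [Module.Finite R M] : (reesGens R M).FG := by
  rw [reesGens, LinearMap.range_eq_map]
  exact Module.Finite.fg_top.map _

theorem reesAlg_eq_zero_of_smul_eq_zero {a : R} (ha : a ∈ R⁰) {x : Rees R M}
    (h : a • x = 0) : x = 0 := by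
  obtain ⟨s, rfl⟩ := reesMk_surjective x
  rw [← map_smul, reesMk_eq_zero_iff] at h
  rw [reesMk_eq_zero_iff]
  obtain ⟨b, hb, hbs⟩ := h
  exact ⟨b * a, mul_mem hb ha, by rw [mul_smul, hbs]⟩

@[elab_as_elim]
theorem reesAlg_induction {p : Rees R M → Prop} (algebraMap : ∀ r, p (algebraMap R _ r))
    (ι : ∀ x, p (reesι R M x)) (mul : ∀ a b, p a → p b → p (a * b))
    (add : ∀ a b, p a → p b → p (a + b)) (b : Rees R M) : p b := by
  obtain ⟨s, rfl⟩ := reesMk_surjective b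
  induction s using SymmetricAlgebra.induction with
  | algebraMap r => rw [AlgHom.commutes]; exact algebraMap r
  | ι x => exact ι x
  | mul a b ha hb => rw [map_mul]; exact mul _ _ ha hb
  | add a b ha hb => rw [map_add]; exact add _ _ ha hb

section Lift

variable {A : Type*} [CommRing A] [Algebra R A]

/-- A linear map to a torsionfree algebra extends to the Rees algebra. -/
noncomputable def reesLift (f : M →ₗ[R] A) (hA : ∀ a ∈ R⁰, ∀ x : A, a • x = 0 → x = 0) :
    Rees R M →ₐ[R] A :=
  Ideal.Quotient.liftₐ (symTorsion R M) (SymmetricAlgebra.lift f) (by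
    rintro s ⟨a, ha, hs⟩
    exact hA a ha _ (by rw [← map_smul, hs, map_zero]))

theorem reesLift_reesι (f : M →ₗ[R] A) (hA : ∀ a ∈ R⁰, ∀ x : A, a • x = 0 → x = 0) (x : M) :
    reesLift f hA (reesι R M x) = f x :=
  SymmetricAlgebra.lift_ι_apply f x

end Lift

/-- The `R`-algebra map `x ↦ x X` that describes the grading of the Rees algebra. -/
noncomputable def coaction : Rees R M →ₐ[R] (Rees R M)[X] :=
  reesLift ((LinearMap.mulRight R (X : (Rees R M)[X])) ∘ₗ (CAlgHom (R := R)).toLinearMap ∘ₗ reesι R M) (by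
    intro a ha x hx
    refine Polynomial.ext fun n => ?_
    rw [coeff_zero]
    exact reesAlg_eq_zero_of_smul_eq_zero ha (by rw [← coeff_smul, hx, coeff_zero]))

theorem coaction_reesι (x : M) : coaction (reesι R M x) = C (reesι R M x) * X := by
  rw [coaction, reesLift_reesι]
  rfl

/-- The coefficients of the coaction serve as the homogeneous components; no grading structure is
set up. -/
theorem coeff_coaction_mem (b : Rees R M) (n : ℕ) :
    (coaction b).coeff n ∈ reesGens R M ^ n := by
  induction b using reesAlg_induction generalizing n with
  | algebraMap r =>
    rw [AlgHom.commutes, Polynomial.algebraMap_apply, coeff_C]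
    split_ifs with h
    · subst h
      rw [pow_zero]
      exact Submodule.algebraMap_mem r
    · exact zero_mem _
  | ι x =>
    rw [coaction_reesι, coeff_C_mul, coeff_X]
    split_ifs with h
    · subst h
      rw [mul_one, pow_one]
      exact reesι_mem_reesGens x
    · simp
  | mul a b ha hb =>
    rw [map_mul, coeff_mul]
    refine Submodule.sum_mem _ fun ij hij => ?_
    rw [← _root_.Finset.HasAntidiagonal.mem_antidiagonal.1 hij, pow_add]
    exact Submodule.mul_mem_mul (ha _) (hb _)
  | add a b ha hb => rw [map_add, coeff_add]; exact add_mem (ha _) (hb _)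

theorem coaction_of_mem_pow {n : ℕ} {w : Rees R M} (hw : w ∈ reesGens R M ^ n) :
    coaction w = C w * X ^ n := by
  induction hw using Submodule.pow_induction_on_left' with
  | algebraMap r => rw [AlgHom.commutes, Polynomial.algebraMap_apply, pow_zero, mul_one]
  | add x y i _ _ hx hy => rw [map_add, hx, hy, C_add, add_mul]
  | mem_mul m hm i x _ hx =>
    obtain ⟨y, rfl⟩ := hm
    rw [map_mul, hx, coaction_reesι, C_mul, Nat.succ_eq_add_one]
    ring

/-- The augmentation of the Rees algebra. -/
noncomputable def reesAug : Rees R M →ₐ[R] R :=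
  reesLift 0 (fun _ ha x hx => (mem_nonZeroDivisors_iff.1 ha).1 x hx)

theorem coeff_zero_coaction (b : Rees R M) :
    (coaction b).coeff 0 = algebraMap R (Rees R M) (reesAug b) := by
  induction b using reesAlg_induction with
  | algebraMap r => simp [Polynomial.algebraMap_apply]
  | ι x => simp [coaction_reesι, reesAug, reesLift_reesι]
  | mul a b ha hb => rw [map_mul, mul_coeff_zero, ha, hb, map_mul, map_mul]
  | add a b ha hb => rw [map_add, coeff_add, ha, hb, map_add, map_add]

variable (R M) in
/-- `M` has a reduction generated by `d` elements, with reduction number at most `N`. -/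
def HasReduction (d N : ℕ) : Prop :=
  ∃ u : Fin d → M, reesGens R M ^ (N + 1) ≤
    Submodule.span R (Set.range fun i => reesι R M (u i)) * reesGens R M ^ N

theorem hasReduction_zero {d : ℕ} {u : Fin d → M} (hu : Submodule.span R (Set.range u) = ⊤) :
    HasReduction R M d 0 := by
  refine ⟨u, ?_⟩
  rw [pow_zero, mul_one, zero_add, pow_one, reesGens, LinearMap.range_eq_map, ← hu,
    Submodule.map_span, ← Set.range_comp]
  rfl

/-- A ring homomorphism on the Rees algebra maps powers of elements of `M` into the ideal generated
by the images of the generators of a reduction. -/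
theorem map_pow_mem_of_le_span_mul {d N : ℕ} {u : Fin d → M}
    (hu : reesGens R M ^ (N + 1) ≤
      Submodule.span R (Set.range fun i => reesι R M (u i)) * reesGens R M ^ N)
    {A : Type*} [CommRing A] [Algebra R A] (θ : Rees R M →ₐ[R] A) {J : Ideal A}
    (hJ : ∀ i, θ (reesι R M (u i)) ∈ J) (x : M) : θ (reesι R M x) ^ (N + 1) ∈ J := by
  have h1 : reesι R M x ^ (N + 1) ∈ (J.comap θ).restrictScalars R := by
    refine (hu.trans (Submodule.mul_le.2 fun m hm n _ => ?_))
      (Submodule.pow_mem_pow _ (reesι_mem_reesGens x) _)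
    refine Ideal.mul_mem_right _ (J.comap θ) ?_
    have : Submodule.span R (Set.range fun i => reesι R M (u i)) ≤
        (J.comap θ).restrictScalars R := by
      rw [Submodule.span_le]
      rintro _ ⟨i, rfl⟩
      exact hJ i
    exact this hm
  rw [← map_pow]
  exact h1

/-- A residue field may have `R`-torsion, so `f` does not lift to the Rees algebra directly. Instead
the embedding of `E` in `R^e` lifts to a map to the torsionfree ring `R[X_1, …, X_e]`, which is then
evaluated at the values of `f` on the basis. The reduction makes `f x ^ (N + 1)` vanish. -/
theorem IsIdealModule.height_annihilator_le_two_of_hasReduction [IsNoetherianRing R] {e : ℕ}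
    {E : Submodule R M} (hE : IsIdealModule e E) (hEG : E < ⊤) {N : ℕ}
    (hN : HasReduction R E (e + 1) N) : (Module.annihilator R (M ⧸ E)).height ≤ 2 := by
  obtain ⟨u, hu⟩ := hN
  obtain ⟨⟨L⟩, -⟩ := id hE
  refine hE.height_annihilator_le_two hEG u fun Q _ f hf x hx => ?_
  let g : E →ₗ[R] MvPolynomial (Fin e) R :=
    Fintype.linearCombination R (fun i => (MvPolynomial.X i : MvPolynomial (Fin e) R)) ∘ₗ
      L.toLinearMap ∘ₗ E.subtype
  have htf : ∀ a ∈ R⁰, ∀ p : MvPolynomial (Fin e) R, a • p = 0 → p = 0 := by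
    intro a ha p hp
    ext m
    have := congrArg (MvPolynomial.coeff m) hp
    rw [MvPolynomial.coeff_smul, MvPolynomial.coeff_zero, smul_eq_mul] at this
    rw [MvPolynomial.coeff_zero]
    exact (mem_nonZeroDivisors_iff.1 ha).1 _ this
  let θ : Rees R E →ₐ[R] Q.ResidueField :=
    (MvPolynomial.aeval fun i => f (L.symm (Pi.single i 1))).comp (reesLift g htf)
  have hθ : ∀ y : E, θ (reesι R E y) = f y := by
    intro y
    simp only [θ, AlgHom.comp_apply, reesLift_reesι]
    simp only [g, LinearMap.comp_apply, Fintype.linearCombination_apply, map_sum, map_smul,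
      MvPolynomial.aeval_X]
    simp_rw [← map_smul]
    rw [← map_sum, ← map_sum]
    congr 1
    apply L.injective
    rw [L.apply_symm_apply]
    exact (pi_eq_sum_univ' _).symm
  have := map_pow_mem_of_le_span_mul hu θ (J := ⊥) (fun i => by rw [hθ, hf]; exact zero_mem _) ⟨x, hx⟩
  rw [hθ] at this
  exact pow_eq_zero_iff (Nat.succ_ne_zero N) |>.1 this

/-! ### Reductions of ideals -/

section IdealReduction

variable {I : Ideal R}

/-- The map from the Rees algebra of an ideal to the ring given by the inclusion. -/
noncomputable def reesEval (I : Ideal R) : Rees R I →ₐ[R] R :=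
  reesLift (Submodule.subtype I) (fun _ ha x hx => (mem_nonZeroDivisors_iff.1 ha).1 x hx)

theorem reesEval_reesι (x : I) : reesEval I (reesι R I x) = x :=
  reesLift_reesι _ _ x

/-- An ideal has the same radical as a reduction of it, so Krull's height theorem for the reduction
applies. -/
theorem height_le_of_hasReduction [IsNoetherianRing R] (hI : I ≠ ⊤) {d N : ℕ}
    (h : HasReduction R I d N) : I.height ≤ d := by
  obtain ⟨u, hu⟩ := h
  set J : Ideal R := Ideal.span (Set.range fun i => (u i : R)) with hJ
  have hJI : J ≤ I := by
    rw [hJ, Ideal.span_le]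
    rintro _ ⟨i, rfl⟩
    exact (u i).2
  have hIJ : I ≤ J.radical := by
    intro x hx
    refine ⟨N + 1, ?_⟩
    have := map_pow_mem_of_le_span_mul hu (reesEval I) (J := J) (fun i => by
      rw [reesEval_reesι]
      exact Ideal.subset_span ⟨i, rfl⟩) ⟨x, hx⟩
    rwa [reesEval_reesι] at this
  have hJt : J ≠ ⊤ := fun h => hI (top_le_iff.1 (h ▸ hJI))
  obtain ⟨P, hP⟩ := Ideal.nonempty_minimalPrimes hJt
  have hIP : I ≤ P := hIJ.trans (hP.1.1.radical_le_iff.2 hP.1.2)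
  refine ((Ideal.height_mono hIP).trans
    (Ideal.height_le_card_of_mem_minimalPrimes_span (Set.finite_range _) hP)).trans ?_
  have : (Set.range fun i => (u i : R)).ncard ≤ d := by
    rw [← Set.image_univ]
    exact (Set.ncard_image_le Set.finite_univ).trans (by simp)
  exact_mod_cast this

/-- With reduction number `0` the `u i` span the degree one component, and `reesEval` identifies
that component with `I`. -/
theorem exists_span_eq_top_of_hasReduction_zero {d : ℕ} (h : HasReduction R I d 0) :
    ∃ u : Fin d → I, Submodule.span R (Set.range u) = ⊤ := by
  obtain ⟨u, hu⟩ := h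
  refine ⟨u, ?_⟩
  rw [pow_zero, mul_one, zero_add, pow_one] at hu
  rw [eq_top_iff]
  intro x _
  have h1 := Submodule.mem_map_of_mem (f := (reesEval I).toLinearMap) (hu (reesι_mem_reesGens x))
  rw [Submodule.map_span, ← Set.range_comp] at h1
  have h2 : (reesEval I).toLinearMap ∘ (fun i => reesι R I (u i)) = I.subtype ∘ u :=
    funext fun i => reesEval_reesι _
  rw [h2, Set.range_comp, ← Submodule.map_span] at h1
  obtain ⟨y, hy, hyx⟩ := h1
  have h3 : y = x := Subtype.ext (hyx.trans (reesEval_reesι x))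
  exact h3 ▸ hy

end IdealReduction

end Rees

/-! ### The Nagata extension -/

section Nagata

variable (R : Type*) [CommRing R] [IsLocalRing R] (σ : Type)

instance [Finite σ] [IsNoetherianRing R] : IsNoetherianRing (Nagata R σ) :=
  IsLocalization.isNoetherianRing (maxIdealExt R σ).primeCompl (Nagata R σ) inferInstance

instance : Module.Flat R (Nagata R σ) :=
  have : Module.Flat (MvPolynomial σ R) (Nagata R σ) :=
    IsLocalization.flat (Nagata R σ) (maxIdealExt R σ).primeCompl
  Module.Flat.trans R (MvPolynomial σ R) (Nagata R σ)

theorem algebraMap_nagata_mem_nonZeroDivisors {a : R} (ha : a ∈ nonZeroDivisors R) :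
    algebraMap R (Nagata R σ) a ∈ nonZeroDivisors (Nagata R σ) := by
  have h1 : IsSMulRegular R a := fun x y h => by
    have : a * (x - y) = 0 := by
      have : a * x = a * y := h
      rw [mul_sub, this, sub_self]
    exact sub_eq_zero.1 ((mem_nonZeroDivisors_iff.1 ha).1 _ this)
  have h2 : IsSMulRegular (Nagata R σ) (algebraMap R (Nagata R σ) a) :=
    IsSMulRegular.of_flat h1
  rw [mem_nonZeroDivisors_iff_right]
  intro x hx
  refine h2 ?_
  simp only [smul_eq_mul, mul_zero]
  rw [mul_comm, hx]

variable {R σ}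

/-- Consequently a polynomial with a unit value at some point `t` becomes a unit in the Nagata
extension. -/
theorem eval_mem_of_mem_maxIdealExt {p : MvPolynomial σ R} (hp : p ∈ maxIdealExt R σ) (t : σ → R) :
    MvPolynomial.eval t p ∈ IsLocalRing.maximalIdeal R := by
  have : maxIdealExt R σ ≤ (IsLocalRing.maximalIdeal R).comap (MvPolynomial.eval t) := by
    rw [maxIdealExt, Ideal.map_le_iff_le_comap]
    intro r hr
    simpa using hr
  exact this hp

instance : IsLocalHom (algebraMap R (Nagata R σ)) := by
  refine ⟨fun r hr => ?_⟩
  rw [IsScalarTower.algebraMap_apply R (MvPolynomial σ R),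
    IsLocalization.AtPrime.isUnit_to_map_iff (Nagata R σ) (maxIdealExt R σ)] at hr
  by_contra h
  exact hr (Ideal.mem_map_of_mem _ h)

instance [Infinite (IsLocalRing.ResidueField R)] :
    Infinite (IsLocalRing.ResidueField (Nagata R σ)) :=
   Infinite.of_injective _ (IsLocalRing.ResidueField.map (algebraMap R (Nagata R σ))).injective

end Nagata

/-! ### From special to generic elements -/

section Transfer

variable {R : Type*} [CommRing R] [IsLocalRing R] {M : Type*} [AddCommGroup M] [Module R M]

/-- The specialization of the indeterminates shows that a reduction of `M` that contains `m`
special combinations of `a_1, …, a_n` stays a reduction when these are replaced by generic ones;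
here the generic combinations are mapped to zero. -/
theorem mem_span_of_generic {n m d N : ℕ} (a : Fin n → M) (u : Fin m → M) (v : Fin d → M)
    (t : Fin n × Fin m → R) (ht : ∀ j, u j = ∑ i, t (i, j) • a i) [Module.Finite R M]
    (hu : reesGens R M ^ (N + 1) ≤ (Submodule.span R (Set.range fun i => reesι R M (u i)) ⊔
      Submodule.span R (Set.range fun i => reesι R M (v i))) * reesGens R M ^ N)
    {B : Type*} [CommRing B] [Algebra (MvPolynomial (Fin n × Fin m) R) B]
    [Algebra (Nagata R (Fin n × Fin m)) B]
    [IsScalarTower (MvPolynomial (Fin n × Fin m) R) (Nagata R (Fin n × Fin m)) B]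
    (ψ : Rees R M →+* B)
    (hψ : ∀ r, ψ (algebraMap R _ r) = algebraMap (MvPolynomial (Fin n × Fin m) R) B
      (MvPolynomial.C r))
    (hx : ∀ j, ∑ i, algebraMap (MvPolynomial (Fin n × Fin m) R) B (MvPolynomial.X (i, j)) *
      ψ (reesι R M (a i)) = 0)
    {w : Rees R M} (hw : w ∈ reesGens R M ^ (N + 1)) :
    ψ w ∈ Submodule.span (Nagata R (Fin n × Fin m))
      {b | ∃ i, ∃ c ∈ reesGens R M ^ N, b = ψ (reesι R M (v i)) * ψ c} := by
  have hev : ∀ i j, MvPolynomial.eval t (MvPolynomial.C (t (i, j)) - MvPolynomial.X (i, j)) = 0 := by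
    intro i j
    simp
  set P := MvPolynomial (Fin n × Fin m) R
  have hsmul : ∀ (r : R) (x : Rees R M), ψ (r • x) = (MvPolynomial.C r : P) • ψ x := by
    intro r x
    rw [Algebra.smul_def, map_mul, hψ, Algebra.smul_def]
  set D : Submodule P B := Submodule.span P (ψ '' (reesGens R M ^ (N + 1) : Submodule R _)) with hD
  set T : Set B := {b | ∃ i, ∃ c ∈ reesGens R M ^ N, b = ψ (reesι R M (v i)) * ψ c} with hT
  set 𝔫 : Ideal P := RingHom.ker (MvPolynomial.eval t) with h𝔫
  have hDfg : D.FG := by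
    classical
    obtain ⟨S, hS⟩ := (reesGens_fg (R := R) (M := M)).pow (N + 1)
    refine ⟨S.image ψ, le_antisymm (Submodule.span_mono ?_) (Submodule.span_le.2 ?_)⟩
    · rw [Finset.coe_image]
      exact Set.image_mono (by rw [← hS]; exact Submodule.subset_span)
    · rintro _ ⟨x, hx, rfl⟩
      rw [SetLike.mem_coe, ← hS] at hx
      induction hx using Submodule.span_induction with
      | mem x hx => exact Submodule.subset_span (by simpa using ⟨x, hx, rfl⟩)
      | zero => rw [map_zero]; exact zero_mem _
      | add x y _ _ hx hy => rw [map_add]; exact add_mem hx hy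
      | smul r x _ hx => rw [hsmul]; exact Submodule.smul_mem _ _ hx
  -- The generic combinations map to zero, so `u j` has the same image as the combination of the `a
  -- i` with coefficients `t (i, j) - X (i, j)`, which lie in `𝔫`.
  have hle : D ≤ Submodule.span P T ⊔ 𝔫 • D := by
    rw [hD, Submodule.span_le, ← hD]
    rintro _ ⟨x, hx', rfl⟩
    have hx'' := hu hx'
    clear hx' hw
    induction hx'' using Submodule.mul_induction_on' with
    | mem_mul_mem y hy c hc =>
      rw [map_mul]
      obtain ⟨y₁, hy₁, y₂, hy₂, rfl⟩ := Submodule.mem_sup.1 hy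
      rw [map_add, add_mul]
      clear hy
      refine add_mem (Submodule.mem_sup_right ?_) (Submodule.mem_sup_left ?_)
      · induction hy₁ using Submodule.span_induction with
        | mem y hy =>
          obtain ⟨j, rfl⟩ := hy
          have : ψ (reesι R M (u j)) * ψ c = ∑ i, (MvPolynomial.C (t (i, j)) -
              MvPolynomial.X (i, j) : P) • (ψ (reesι R M (a i)) * ψ c) := by
            have h0 : ψ (reesι R M (u j)) = ∑ i, (MvPolynomial.C (t (i, j)) -
                MvPolynomial.X (i, j) : P) • ψ (reesι R M (a i)) := by
              simp_rw [sub_smul, Finset.sum_sub_distrib]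
              rw [ht, map_sum, map_sum]
              simp_rw [map_smul, hsmul]
              rw [eq_sub_iff_add_eq, add_eq_left, ← hx j]
              simp_rw [Algebra.smul_def]
              rfl
            rw [h0, Finset.sum_mul]
            simp_rw [smul_mul_assoc]
          rw [this]
          refine Submodule.sum_mem _ fun i _ => Submodule.smul_mem_smul ?_ ?_
          · exact RingHom.mem_ker.2 (hev i j)
          · rw [← map_mul]
            refine Submodule.subset_span ⟨_, ?_, rfl⟩
            rw [pow_succ']
            exact Submodule.mul_mem_mul (reesι_mem_reesGens _) hc
        | zero => rw [map_zero, zero_mul]; exact zero_mem _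
        | add x y _ _ hx hy => rw [map_add, add_mul]; exact add_mem hx hy
        | smul r x _ hx => rw [hsmul, smul_mul_assoc]; exact Submodule.smul_mem _ _ hx
      · induction hy₂ using Submodule.span_induction with
        | mem y hy =>
          obtain ⟨j, rfl⟩ := hy
          exact Submodule.subset_span ⟨j, c, hc, rfl⟩
        | zero => rw [map_zero, zero_mul]; exact zero_mem _
        | add x y _ _ hx hy => rw [map_add, add_mul]; exact add_mem hx hy
        | smul r x _ hx => rw [hsmul, smul_mul_assoc]; exact Submodule.smul_mem _ _ hx
    | add x _ y _ hx hy => rw [map_add]; exact add_mem hx hy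
  -- Nakayama's lemma in determinantal form, as `𝔫` need not lie in the Jacobson radical of `R[Z]`.
  -- The multiplier `r` has value `1` at `t`, so it is invertible in the Nagata extension.
  obtain ⟨r, hr, hrD⟩ := Submodule.exists_sub_one_mem_and_smul_le_of_fg_of_le_sup hDfg le_rfl hle
  have hrunit : IsUnit (algebraMap P (Nagata R (Fin n × Fin m)) r) := by
    rw [IsLocalization.AtPrime.isUnit_to_map_iff _ (maxIdealExt R (Fin n × Fin m))]
    intro hmem
    have h1 := eval_mem_of_mem_maxIdealExt hmem t
    rw [h𝔫, RingHom.mem_ker, map_sub, map_one, sub_eq_zero] at hr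
    rw [hr] at h1
    exact (IsLocalRing.maximalIdeal.isMaximal R).ne_top ((Ideal.eq_top_iff_one _).2 h1)
  have h1 : r • ψ w ∈ Submodule.span P T :=
    hrD (Submodule.smul_mem_pointwise_smul _ _ _ (Submodule.subset_span ⟨w, hw, rfl⟩))
  have h2 : r • ψ w ∈ Submodule.span (Nagata R (Fin n × Fin m)) T :=
    Submodule.span_subset_span P (Nagata R (Fin n × Fin m)) T h1
  rw [← IsScalarTower.algebraMap_smul (Nagata R (Fin n × Fin m)) r] at h2
  obtain ⟨s, hs⟩ := hrunit
  rw [← hs] at h2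
  have h3 := Submodule.smul_mem _ (↑s⁻¹ : Nagata R (Fin n × Fin m)) h2
  rwa [smul_smul, Units.inv_mul, one_smul] at h3

end Transfer
-- Generic Bourbaki ideals: properness and reductions
section Bourbaki

variable {R : Type*} [CommRing R] [IsLocalRing R] {M : Type*} [AddCommGroup M] [Module R M]

/-- Both numbers are dimensions over residue fields, and a field extension preserves dimension. -/
theorem spanFinrank_baseChange_nagata [Module.Finite R M] (σ : Type) :
    (⊤ : Submodule R M).spanFinrank ≤
      (⊤ : Submodule (Nagata R σ) (Nagata R σ ⊗[R] M)).spanFinrank := by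
  set S := Nagata R σ
  set k := IsLocalRing.ResidueField R
  set l := IsLocalRing.ResidueField S
  rw [← TensorProduct.spanFinrank_top_eq_of_residueField (⊤ : Submodule R M) Module.Finite.fg_top,
    ← TensorProduct.spanFinrank_top_eq_of_residueField (⊤ : Submodule S (S ⊗[R] M))
      Module.Finite.fg_top, ← Module.finrank_eq_spanFinrank_of_free,
    ← Module.finrank_eq_spanFinrank_of_free]
  let e₁ : l ⊗[S] (⊤ : Submodule S (S ⊗[R] M)) ≃ₗ[l] l ⊗[S] (S ⊗[R] M) :=
    TensorProduct.AlgebraTensorModule.congr (LinearEquiv.refl l l) Submodule.topEquiv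
  let e₂ : l ⊗[S] (S ⊗[R] M) ≃ₗ[l] l ⊗[R] M :=
    TensorProduct.AlgebraTensorModule.cancelBaseChange R S l l M
  let e₃ : l ⊗[R] M ≃ₗ[l] l ⊗[k] (k ⊗[R] M) :=
    (TensorProduct.AlgebraTensorModule.cancelBaseChange R k l l M).symm
  let e₄ : k ⊗[R] (⊤ : Submodule R M) ≃ₗ[k] k ⊗[R] M :=
    TensorProduct.AlgebraTensorModule.congr (LinearEquiv.refl k k) Submodule.topEquiv
  rw [(e₁.trans (e₂.trans e₃)).finrank_eq, e₄.finrank_eq]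
  exact (Module.finrank_baseChange (R := l) (S := k) (M' := k ⊗[R] M)).ge

/-- An ideal of grade at least two that is the quotient of an ideal module of rank `e` by a
submodule generated by `e - 1` elements is proper. -/
theorem bourbaki_ne_top [IsNoetherianRing R] {e : ℕ} (he : 0 < e) {E : Submodule R M}
    (hE : IsIdealModule e E) (hEG : E < ⊤) {n : ℕ} {a : Fin n → E}
    {I : Ideal (Nagata R (Fin n × Fin (e - 1)))} (hI : IsGoodGenericBourbakiIdeal R a e I) :
    I ≠ ⊤ := by
  rintro rfl
  obtain ⟨-, ⟨φ⟩, -⟩ := hI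
  have hfin : Module.Finite R E := by
    obtain ⟨⟨L⟩, -⟩ := hE
    have : Module.Finite R M := Module.Finite.equiv L.symm
    infer_instance
  set S := Nagata R (Fin n × Fin (e - 1))
  set F := genericSubmodule R a (e - 1)
  obtain ⟨g, hg⟩ := F.mkQ_surjective (φ.symm ⟨1, trivial⟩)
  -- If `I` were the unit ideal, `E''/F` would be cyclic, and the generic elements with a lift `g`
  -- of its generator would generate `E''` by `e` elements. Then so would `E` be, which
  -- `span_ne_top` excludes.
  set y : Fin (e - 1 + 1) → S ⊗[R] E := Fin.snoc
    (fun j : Fin (e - 1) => ∑ i : Fin n, nagataVar R (i, j) ⊗ₜ[R] a i) g with hy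
  have hspan : Submodule.span S (Set.range y) = ⊤ := by
    rw [eq_top_iff]
    intro z _
    have hz : z - (φ (F.mkQ z) : S) • g ∈ F := by
      rw [← Submodule.Quotient.mk_eq_zero, Submodule.Quotient.mk_sub, sub_eq_zero,
        Submodule.Quotient.mk_smul]
      have hg' : Submodule.Quotient.mk g = φ.symm ⟨1, trivial⟩ := hg
      rw [hg']
      apply φ.injective
      rw [map_smul, LinearEquiv.apply_symm_apply]
      ext
      simp
    have hFle : F ≤ Submodule.span S (Set.range y) := by
      refine Submodule.span_mono ?_
      rintro _ ⟨j, rfl⟩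
      exact ⟨j.castSucc, by simp [hy]⟩
    rw [← sub_add_cancel z ((φ (F.mkQ z) : S) • g)]
    refine add_mem (hFle hz) (Submodule.smul_mem _ _ (Submodule.subset_span ⟨Fin.last _, ?_⟩))
    simp [hy]
  have h1 := spanFinrank_top_le_of_span_range_eq_top hspan
  have h2 := (spanFinrank_baseChange_nagata (R := R) (M := E) (Fin n × Fin (e - 1))).trans h1
  rw [Nat.sub_add_cancel he] at h2
  obtain ⟨u, hu⟩ := exists_fin_span_eq_top_of_spanFinrank_le h2
  exact hE.span_ne_top hEG u hu

theorem hasReduction_bourbaki [Module.Finite R M] {e : ℕ} (he : 0 < e) {N : ℕ}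
    (hM : HasReduction R M (e + 1) N) {n : ℕ} {a : Fin n → M}
    {I : Ideal (Nagata R (Fin n × Fin (e - 1)))} (hI : IsGoodGenericBourbakiIdeal R a e I) :
    HasReduction (Nagata R (Fin n × Fin (e - 1))) I 2 N := by
  obtain ⟨ha, ⟨φ⟩, -⟩ := hI
  obtain ⟨m, rfl⟩ : ∃ m, e = m + 1 := ⟨e - 1, by omega⟩
  obtain ⟨y, hy⟩ := hM
  change Ideal (Nagata R (Fin n × Fin m)) at I
  set F := genericSubmodule R a m with hF
  change (_ ⧸ F) ≃ₗ[Nagata R (Fin n × Fin m)] I at φ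
  change HasReduction (Nagata R (Fin n × Fin m)) I 2 N
  let f : M → I := fun x => φ (F.mkQ (1 ⊗ₜ x))
  have hf_add : ∀ x x', f (x + x') = f x + f x' := fun x x' => by
    simp only [f, TensorProduct.tmul_add, map_add]
  have hf_smul : ∀ (r : R) x, f (r • x) = algebraMap R (Nagata R (Fin n × Fin m)) r • f x := by
    intro r x
    simp only [f, ← map_smul]
    congr 2
    rw [TensorProduct.smul_tmul', smul_eq_mul, mul_one, TensorProduct.tmul_smul,
      TensorProduct.smul_tmul', Algebra.smul_def, mul_one]
  set S := Nagata R (Fin n × Fin m) with hS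
  let _ : Algebra R (Rees S I) := ((algebraMap S (Rees S I)).comp (algebraMap R S)).toAlgebra
  let _ : Algebra (MvPolynomial (Fin n × Fin m) R) (Rees S I) :=
    ((algebraMap S (Rees S I)).comp (algebraMap (MvPolynomial (Fin n × Fin m) R) S)).toAlgebra
  have : IsScalarTower (MvPolynomial (Fin n × Fin m) R) S (Rees S I) :=
    IsScalarTower.of_algebraMap_eq fun _ => rfl
  have hsm : ∀ (r : R) (x : Rees S I), r • x = algebraMap R S r • x := fun r x => by
    rw [Algebra.smul_def, Algebra.smul_def]; rfl
  let g : M →ₗ[R] Rees S I :=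
    { toFun := fun x => reesι S I (f x)
      map_add' := fun x x' => by rw [hf_add, map_add]
      map_smul' := fun r x => by rw [hf_smul, map_smul, RingHom.id_apply, hsm] }
  -- The lift exists because nonzerodivisors of `R` stay nonzerodivisors in the flat extension `S`.
  let ψ : Rees R M →ₐ[R] Rees S I := reesLift g fun r hr x hx =>
    reesAlg_eq_zero_of_smul_eq_zero (algebraMap_nagata_mem_nonZeroDivisors R _ hr)
      (by rw [← hsm]; exact hx)
  have hψι : ∀ x, ψ (reesι R M x) = reesι S I (f x) := fun x => reesLift_reesι _ _ x
  have htop : Submodule.span S (Set.range f) = ⊤ := by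
    rw [eq_top_iff]
    intro z _
    obtain ⟨t, ht⟩ := F.mkQ_surjective (φ.symm z)
    have hz : z = φ (F.mkQ t) := by rw [ht, φ.apply_symm_apply]
    rw [hz]
    clear ht hz
    induction t using TensorProduct.induction_on with
    | zero => simp
    | tmul s x =>
      have : s ⊗ₜ[R] x = s • ((1 : S) ⊗ₜ[R] x) := by simp [TensorProduct.smul_tmul']
      rw [this, map_smul, map_smul]
      exact Submodule.smul_mem _ _ (Submodule.subset_span ⟨x, rfl⟩)
    | add x y hx hy => rw [map_add, map_add]; exact add_mem hx hy
  have hcoef : ∀ x : M, ∃ t : Fin n → R, x = ∑ i, t i • a i := by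
    intro x
    have hx : x ∈ Submodule.span R (Set.range a) := by rw [ha]; trivial
    obtain ⟨t, ht⟩ := (Submodule.mem_span_range_iff_exists_fun R).1 hx
    exact ⟨t, ht.symm⟩
  choose t ht using hcoef
  -- Of the `e + 1 = m + 2` members of the reduction, `m` are traded for the generic elements and
  -- two survive.
  let u : Fin m → M := fun j => y (Fin.castAdd 2 j)
  let v : Fin 2 → M := fun j => y (Fin.natAdd m j)
  have hsplit : Submodule.span R (Set.range fun i => reesι R M (y i)) ≤
      Submodule.span R (Set.range fun i => reesι R M (u i)) ⊔
        Submodule.span R (Set.range fun i => reesι R M (v i)) := by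
    rw [Submodule.span_le]
    rintro _ ⟨i, rfl⟩
    induction i using Fin.addCases (m := m) (n := 2) with
    | left i => exact Submodule.mem_sup_left (Submodule.subset_span ⟨i, rfl⟩)
    | right i => exact Submodule.mem_sup_right (Submodule.subset_span ⟨i, rfl⟩)
  have hx : ∀ j, ∑ i, algebraMap (MvPolynomial (Fin n × Fin m) R) (Rees S I)
      (MvPolynomial.X (i, j)) * ψ (reesι R M (a i)) = 0 := by
    intro j
    have h0 : φ (F.mkQ (∑ i : Fin n, nagataVar R (i, j) ⊗ₜ[R] a i)) = 0 := by
      rw [Submodule.mkQ_apply, (Submodule.Quotient.mk_eq_zero F).2, map_zero]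
      exact Submodule.subset_span ⟨j, rfl⟩
    rw [← map_zero (reesι S I), ← h0, map_sum, map_sum, map_sum]
    refine Finset.sum_congr rfl fun i _ => ?_
    have : nagataVar R (i, j) ⊗ₜ[R] a i = nagataVar R (i, j) • ((1 : S) ⊗ₜ[R] a i) := by
      simp [TensorProduct.smul_tmul']
    rw [this, map_smul, map_smul, map_smul, hψι, Algebra.smul_def]
    rfl
  have key := fun w hw => mem_span_of_generic (w := w) a u v (fun p => t (u p.2) p.1)
    (fun j => ht (u j)) (hy.trans (mul_le_mul' hsplit le_rfl))
    (B := Rees S I) ψ.toRingHom (fun r => ψ.commutes r) hx hw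
  refine ⟨fun j => f (v j), ?_⟩
  have hgens : reesGens S I = Submodule.span S (ψ '' (reesGens R M : Set (Rees R M))) := by
    rw [reesGens, LinearMap.range_eq_map, ← htop, Submodule.map_span]
    congr 1
    ext z
    constructor
    · rintro ⟨_, ⟨x, rfl⟩, rfl⟩
      exact ⟨_, reesι_mem_reesGens x, hψι x⟩
    · rintro ⟨_, ⟨x, rfl⟩, rfl⟩
      exact ⟨_, ⟨x, rfl⟩, (hψι x).symm⟩
  have hpow : ∀ k, ∀ w ∈ reesGens R M ^ k, ψ w ∈ reesGens S I ^ k := by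
    intro k w hw
    induction hw using Submodule.pow_induction_on_left' with
    | algebraMap r =>
      rw [AlgHom.commutes, pow_zero]
      exact Submodule.algebraMap_mem (algebraMap R S r)
    | add x y i _ _ hx hy => rw [map_add]; exact add_mem hx hy
    | mem_mul m hm i x _ hx =>
      obtain ⟨y, rfl⟩ := hm
      rw [map_mul, Nat.succ_eq_add_one, pow_succ', hψι]
      exact Submodule.mul_mem_mul (reesι_mem_reesGens _) hx
  have hpow' : ∀ k, reesGens S I ^ k ≤
      Submodule.span S (ψ '' ((reesGens R M ^ k : Submodule R (Rees R M)) : Set (Rees R M))) := by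
    intro k
    rw [hgens, Submodule.span_pow, Submodule.span_le]
    intro z hz
    rw [← Set.image_pow] at hz
    obtain ⟨w, hw, rfl⟩ := hz
    exact Submodule.subset_span ⟨w, Submodule.pow_subset_pow _ hw, rfl⟩
  refine (hpow' _).trans (Submodule.span_le.2 ?_)
  rintro _ ⟨w, hw, rfl⟩
  refine Submodule.span_le.2 ?_ (key w hw)
  rintro _ ⟨i, c, hc, rfl⟩
  refine Submodule.mul_mem_mul (Submodule.subset_span ⟨i, ?_⟩) (hpow _ c hc)
  exact (hψι _).symm

end Bourbaki
-- Analytic spread and reductions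
section Spread

open Polynomial

/-- By incomparability, contraction is strictly monotone; its values contain `J`. -/
theorem ringKrullDim_le_of_isIntegral {P A : Type*} [CommRing P] [CommRing A] [Algebra P A]
    [Algebra.IsIntegral P A] (J : Ideal P) (hJ : ∀ x ∈ J, algebraMap P A x = 0) :
    ringKrullDim A ≤ ringKrullDim (P ⧸ J) := by
  rw [ringKrullDim_quotient]
  let f : PrimeSpectrum A → PrimeSpectrum.zeroLocus (R := P) J := fun q =>
    ⟨⟨q.asIdeal.comap (algebraMap P A), inferInstance⟩, fun x hx => by
      change algebraMap P A x ∈ q.asIdeal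
      rw [hJ x hx]
      exact zero_mem _⟩
  refine Order.krullDim_le_of_strictMono f fun p q hpq => ?_
  have := q.isPrime
  have := p.isPrime
  exact Ideal.IsIntegral.comap_lt_comap hpq

variable {R : Type*} [CommRing R] {M : Type*} [AddCommGroup M] [Module R M]

theorem rees_eq_eval_coaction (b : Rees R M) : (coaction b).eval 1 = b := by
  induction b using reesAlg_induction with
  | algebraMap r => simp [Polynomial.algebraMap_apply]
  | ι x => simp [coaction_reesι]
  | mul a b ha hb => rw [map_mul, eval_mul, ha, hb]
  | add a b ha hb => rw [map_add, eval_add, ha, hb]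

theorem rees_mem_of_forall_pow (W : AddSubmonoid (Rees R M))
    (h : ∀ n, ∀ w ∈ reesGens R M ^ n, w ∈ W) (b : Rees R M) : b ∈ W := by
  rw [← rees_eq_eval_coaction b, eval_eq_sum_range]
  refine sum_mem fun n _ => ?_
  rw [one_pow, mul_one]
  exact h n _ (coeff_coaction_mem b n)

instance [IsNoetherianRing R] [Module.Finite R M] : IsNoetherianRing (Rees R M) := by
  have : Algebra.FiniteType R (Rees R M) := by
    obtain ⟨S, hS⟩ := Module.Finite.fg_top (R := R) (M := M)
    classical
    refine ⟨S.image (reesι R M), ?_⟩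
    rw [eq_top_iff]
    intro b _
    induction b using reesAlg_induction with
    | algebraMap r => exact Subalgebra.algebraMap_mem _ r
    | ι x =>
      have hx : x ∈ Submodule.span R (S : Set M) := by rw [hS]; trivial
      have := Submodule.mem_map_of_mem (f := reesι R M) hx
      rw [Submodule.map_span] at this
      rw [Finset.coe_image]
      exact Algebra.span_le_adjoin R _ this
    | mul a b ha hb => exact mul_mem (ha trivial) (hb trivial)
    | add a b ha hb => exact add_mem (ha trivial) (hb trivial)
  exact Algebra.FiniteType.isNoetherianRing R _

variable [IsLocalRing R]

variable (R M) in
theorem analyticSpread_eq : analyticSpread R M =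
    ringKrullDim (Rees R M ⧸ (IsLocalRing.maximalIdeal R).map (algebraMap R (Rees R M))) :=
  rfl

/-- The analytic spread is at most the number of generators of a reduction. -/
theorem analyticSpread_le_of_hasReduction [Module.Finite R M] {d N : ℕ}
    (h : HasReduction R M d N) : analyticSpread R M ≤ d := by
  obtain ⟨u, hu⟩ := h
  set K : Ideal (Rees R M) := (IsLocalRing.maximalIdeal R).map (algebraMap R (Rees R M)) with hK
  rw [analyticSpread_eq, ← hK]
  let P := MvPolynomial (Fin d) R
  let π : Rees R M →ₐ[R] Rees R M ⧸ K := Ideal.Quotient.mkₐ R K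
  let _ : Algebra P (Rees R M ⧸ K) :=
    (MvPolynomial.aeval fun i => π (reesι R M (u i))).toRingHom.toAlgebra
  have : IsScalarTower R P (Rees R M ⧸ K) := IsScalarTower.of_algebraMap_eq fun r =>
    ((MvPolynomial.aeval fun i => π (reesι R M (u i))).commutes r).symm
  have hX : ∀ i, algebraMap P (Rees R M ⧸ K) (MvPolynomial.X i) = π (reesι R M (u i)) :=
    fun i => MvPolynomial.aeval_X _ i
  have hfg : ∀ i : ℕ, ∃ S : Finset (Rees R M), Submodule.span R (S : Set _) = reesGens R M ^ i :=
    fun i => reesGens_fg.pow i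
  choose S hS using hfg
  classical
  -- Beyond degree `N` every component is reached by multiplying with the `u i`, so generators of
  -- degrees up to `N` make the fiber cone finite over `R[X_1, …, X_d]`. The action factors through
  -- `k[X_1, …, X_d]`, of dimension `d`.
  set T : Finset (Rees R M ⧸ K) := (Finset.range (N + 1)).biUnion fun i => (S i).image π with hT
  set W : Submodule P (Rees R M ⧸ K) := Submodule.span P (T : Set _) with hW
  have hlow : ∀ n ≤ N, ∀ w ∈ reesGens R M ^ n, π w ∈ W := by
    intro n hn w hw
    rw [← hS] at hw
    have h1 := Submodule.mem_map_of_mem (f := π.toLinearMap) hw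
    rw [Submodule.map_span] at h1
    refine Submodule.span_subset_span R P _ (Submodule.span_mono ?_ h1)
    rintro _ ⟨x, hx, rfl⟩
    simp only [hT, Finset.coe_biUnion, Set.mem_iUnion, Finset.coe_image]
    exact ⟨n, by simpa using Nat.lt_succ_of_le hn, x, hx, rfl⟩
  have hall : ∀ n, ∀ w ∈ reesGens R M ^ n, π w ∈ W := by
    intro n
    induction n with
    | zero => exact hlow 0 (Nat.zero_le _)
    | succ n ih =>
      by_cases hn : n + 1 ≤ N
      · exact hlow _ hn
      · intro w hw
        obtain ⟨j, rfl⟩ : ∃ j, n = N + j := ⟨n - N, by omega⟩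
        have hle : reesGens R M ^ (N + j + 1) ≤
            Submodule.span R (Set.range fun i => reesι R M (u i)) * reesGens R M ^ (N + j) := by
          rw [show N + j + 1 = N + 1 + j by ring, pow_add _ (N + 1), pow_add _ N j, ← mul_assoc]
          exact mul_le_mul' hu le_rfl
        have hw' := hle hw
        clear hw
        induction hw' using Submodule.mul_induction_on' with
        | mem_mul_mem y hy c hc =>
          induction hy using Submodule.span_induction with
          | mem y hy =>
            obtain ⟨i, rfl⟩ := hy
            rw [map_mul, ← hX, ← Algebra.smul_def]
            exact Submodule.smul_mem _ _ (ih c hc)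
          | zero => rw [zero_mul, map_zero]; exact zero_mem _
          | add x y _ _ hx hy => rw [add_mul, map_add]; exact add_mem hx hy
          | smul r x _ hx =>
            rw [smul_mul_assoc, map_smul, ← IsScalarTower.algebraMap_smul P r]
            exact Submodule.smul_mem _ _ hx
        | add x _ y _ hx hy => rw [map_add]; exact add_mem hx hy
  have hfin : Module.Finite P (Rees R M ⧸ K) := by
    refine ⟨T, ?_⟩
    rw [eq_top_iff]
    intro b _
    obtain ⟨b, rfl⟩ := Ideal.Quotient.mk_surjective b
    exact rees_mem_of_forall_pow (W.toAddSubmonoid.comap (π : Rees R M →+ Rees R M ⧸ K)) hall b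
  refine (ringKrullDim_le_of_isIntegral
    ((IsLocalRing.maximalIdeal R).map (MvPolynomial.C : R →+* P)) ?_).trans ?_
  · intro x hx
    have : (IsLocalRing.maximalIdeal R).map (MvPolynomial.C : R →+* P) ≤
        RingHom.ker (algebraMap P (Rees R M ⧸ K)) := by
      rw [Ideal.map_le_iff_le_comap]
      intro r hr
      rw [Ideal.mem_comap, RingHom.mem_ker]
      have h1 : algebraMap P (Rees R M ⧸ K) (MvPolynomial.C r) = algebraMap R _ r :=
        (IsScalarTower.algebraMap_apply R P (Rees R M ⧸ K) r).symm
      rw [h1]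
      exact Ideal.Quotient.eq_zero_iff_mem.2 (Ideal.mem_map_of_mem _ hr)
    exact this hx
  · rw [ringKrullDim_eq_of_ringEquiv (MvPolynomial.quotientEquivQuotientMvPolynomial
      (σ := Fin d) (IsLocalRing.maximalIdeal R)).symm.toRingEquiv]
    let _ : Field (R ⧸ IsLocalRing.maximalIdeal R) := Ideal.Quotient.field _
    rw [MvPolynomial.ringKrullDim_of_isNoetherianRing, ringKrullDim_eq_zero_of_field]
    simp

/-- Over a local ring with infinite residue field, finitely many proper submodules that contain
`𝔪M` do not cover `M`. -/
theorem exists_notMem_of_infinite_residueField [Infinite (IsLocalRing.ResidueField R)]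
    (s : Finset (Submodule R M)) (hs : ∀ p ∈ s, p ≠ ⊤ ∧
      ∀ r ∈ IsLocalRing.maximalIdeal R, ∀ x, r • x ∈ p) : ∃ x, ∀ p ∈ s, x ∉ p := by
  by_contra! hc
  have hcov : ⋃ p ∈ s, (p : Set M) = Set.univ := by
    rw [Set.eq_univ_iff_forall]
    intro x
    obtain ⟨p, hp, hx⟩ := hc x
    exact Set.mem_iUnion₂.2 ⟨p, hp, hx⟩
  -- In a finite cover by submodules some member has finite index; the infinite residue field would
  -- embed in the finite quotient by it.
  obtain ⟨p, hp, hfi⟩ := Submodule.exists_finiteIndex_of_cover hcov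
  have hfin : Finite (M ⧸ p) := AddSubgroup.finite_quotient_of_finiteIndex
  obtain ⟨hne, hm⟩ := hs p hp
  obtain ⟨x, hx⟩ : ∃ x, x ∉ p := by
    by_contra! h
    exact hne (eq_top_iff.2 fun x _ => h x)
  let f : R →ₗ[R] M ⧸ p := LinearMap.toSpanSingleton R _ (p.mkQ x)
  have hf : LinearMap.ker f = IsLocalRing.maximalIdeal R := by
    refine le_antisymm (IsLocalRing.le_maximalIdeal fun h => hx ?_) fun r hr => ?_
    · have : f 1 = 0 := by rw [← LinearMap.mem_ker, h]; trivial
      simpa [f] using this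
    · rw [LinearMap.mem_ker]
      have : f r = p.mkQ (r • x) := by simp [f]
      rw [this, Submodule.mkQ_apply, Submodule.Quotient.mk_eq_zero]
      exact hm r hr x
  have hinj := LinearMap.ker_eq_bot.1 (Submodule.ker_liftQ_eq_bot _ f hf.ge hf.le)
  have : Finite (R ⧸ IsLocalRing.maximalIdeal R) := Finite.of_injective _ hinj
  exact Infinite.not_finite (α := IsLocalRing.ResidueField R) this

/-- A sequence of general elements of `M`: a prime containing `d` of them but not all of `M` has
height at least `d`. -/
theorem exists_general_elements [Infinite (IsLocalRing.ResidueField R)] {A : Type*} [CommRing A]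
    [IsNoetherianRing A] [Algebra R A]
    (hA : ∀ r ∈ IsLocalRing.maximalIdeal R, algebraMap R A r = 0) (g : M →ₗ[R] A) (d : ℕ) :
    ∃ u : Fin d → M, ∀ Q : Ideal A, Q.IsPrime → (∀ i, g (u i) ∈ Q) → (∃ x, g x ∉ Q) →
      (d : ℕ∞) ≤ Q.height := by
  induction d with
  | zero => exact ⟨Fin.elim0, fun Q _ _ _ => by simp⟩
  | succ d ih =>
    obtain ⟨u, hu⟩ := ih
    classical
    set J : Ideal A := Ideal.span (Set.range fun i => g (u i)) with hJ
    have hfin := Ideal.finite_minimalPrimes_of_isNoetherianRing A J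
    -- The new element must avoid the minimal primes of `J` that do not contain the whole image of
    -- `M`; the filter drops the others.
    let s : Finset (Submodule R M) := (hfin.toFinset.image
      fun Q => (Q.restrictScalars R).comap g).filter fun p => p ≠ ⊤
    obtain ⟨x, hx⟩ := exists_notMem_of_infinite_residueField s (by
      intro p hp
      simp only [s, Finset.mem_filter, Finset.mem_image] at hp
      obtain ⟨⟨Q, -, rfl⟩, hne⟩ := hp
      refine ⟨hne, fun r hr x => ?_⟩
      rw [Submodule.mem_comap, map_smul, Algebra.smul_def, hA r hr, zero_mul]
      exact zero_mem _)
    refine ⟨Fin.snoc u x, fun Q hQ hmem hex => ?_⟩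
    have hJQ : J ≤ Q := by
      rw [hJ, Ideal.span_le]
      rintro _ ⟨i, rfl⟩
      simpa using hmem i.castSucc
    obtain ⟨Q₀, hQ₀, hle⟩ := Ideal.exists_minimalPrimes_le hJQ
    have hQ₀p := hQ₀.1.1
    obtain ⟨y, hy⟩ := hex
    have hy₀ : g y ∉ Q₀ := fun h => hy (hle h)
    have hxQ₀ : g x ∉ Q₀ := by
      refine fun h => hx ((Q₀.restrictScalars R).comap g) ?_ h
      simp only [s, Finset.mem_filter, Finset.mem_image]
      exact ⟨⟨Q₀, by simpa using hQ₀, rfl⟩, fun h => hy₀ (by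
        have : y ∈ (Q₀.restrictScalars R).comap g := by rw [h]; trivial
        exact this)⟩
    have hxQ : g x ∈ Q := by simpa using hmem (Fin.last d)
    have hlt : Q₀ < Q := lt_of_le_of_ne hle fun h => hxQ₀ (h ▸ hxQ)
    have h1 := hu Q₀ hQ₀p (fun i => hQ₀.1.2 (Ideal.subset_span ⟨i, rfl⟩)) ⟨y, hy₀⟩
    push_cast
    exact (add_le_add_left h1 1).trans (Ideal.height_add_one_le_of_lt_of_isPrime hlt)

/-- The ideal of the Rees algebra generated by the maximal ideal and by elements `u_i` of
degree one. -/
noncomputable def fiberIdeal {d : ℕ} (u : Fin d → M) : Ideal (Rees R M) :=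
  Ideal.span (algebraMap R (Rees R M) '' IsLocalRing.maximalIdeal R ∪
    Set.range (fun i => reesι R M (u i)))

/-- Homogeneity of the ideal, whose generators have degrees zero and one. The factor `b` carries the
induction through multiples of generators. -/
theorem coeff_coaction_mem_fiberIdeal {d : ℕ} (u : Fin d → M) :
    ∀ j ∈ fiberIdeal u, ∀ (b : Rees R M) (n : ℕ), (coaction (b * j)).coeff n ∈ fiberIdeal u := by
  intro j hj
  induction hj using Submodule.span_induction with
  | mem j hj =>
    intro b n
    rcases hj with ⟨r, hr, rfl⟩ | ⟨i, rfl⟩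
    · rw [map_mul, AlgHom.commutes, Polynomial.algebraMap_apply, coeff_mul_C]
      exact Ideal.mul_mem_left _ _ (Ideal.subset_span (Or.inl ⟨r, hr, rfl⟩))
    · rw [map_mul, coaction_reesι, ← mul_assoc]
      cases n with
      | zero => rw [coeff_mul_X_zero]; exact zero_mem _
      | succ n =>
        rw [coeff_mul_X, coeff_mul_C]
        exact Ideal.mul_mem_left _ _ (Ideal.subset_span (Or.inr ⟨i, rfl⟩))
  | zero => intro b n; simp
  | add x y _ _ hx hy =>
    intro b n
    rw [mul_add, map_add, coeff_add]
    exact add_mem (hx b n) (hy b n)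
  | smul a x _ hx => intro b n; rw [smul_eq_mul, ← mul_assoc]; exact hx _ n

/-- The components of positive degree of the elements of `fiberIdeal u`. -/
theorem coeff_succ_coaction_mem {d : ℕ} (u : Fin d → M) (n : ℕ) :
    ∀ j ∈ fiberIdeal u, ∀ b : Rees R M, (coaction (b * j)).coeff (n + 1) ∈
      Submodule.span R (Set.range fun i => reesι R M (u i)) * reesGens R M ^ n ⊔
        IsLocalRing.maximalIdeal R • reesGens R M ^ (n + 1) := by
  intro j hj
  induction hj using Submodule.span_induction with
  | mem j hj =>
    intro b
    rcases hj with ⟨r, hr, rfl⟩ | ⟨i, rfl⟩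
    · rw [map_mul, AlgHom.commutes, Polynomial.algebraMap_apply, coeff_mul_C,
        mul_comm _ (algebraMap _ _ r), ← Algebra.smul_def]
      exact Submodule.mem_sup_right (Submodule.smul_mem_smul hr (coeff_coaction_mem b _))
    · rw [map_mul, coaction_reesι, ← mul_assoc, coeff_mul_X, coeff_mul_C, mul_comm _ (reesι R M (u i))]
      exact Submodule.mem_sup_left
        (Submodule.mul_mem_mul (Submodule.subset_span ⟨i, rfl⟩) (coeff_coaction_mem b _))
  | zero => intro b; simp
  | add x y _ _ hx hy =>
    intro b
    rw [mul_add, map_add, coeff_add]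
    exact add_mem (hx b) (hy b)
  | smul a x _ hx => intro b; rw [smul_eq_mul, ← mul_assoc]; exact hx _

theorem map_maximalIdeal_le_fiberIdeal {d : ℕ} (u : Fin d → M) :
    (IsLocalRing.maximalIdeal R).map (algebraMap R (Rees R M)) ≤ fiberIdeal u :=
  Ideal.span_mono Set.subset_union_left

variable (R M) in
/-- The irrelevant maximal ideal of the Rees algebra. -/
noncomputable def irrelevantIdeal : Ideal (Rees R M) :=
  (IsLocalRing.maximalIdeal R).comap (reesAug (R := R) (M := M))

instance : (irrelevantIdeal R M).IsPrime :=
  inferInstanceAs ((IsLocalRing.maximalIdeal R).comap (reesAug (R := R) (M := M))).IsPrime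

theorem map_maximalIdeal_le_irrelevantIdeal :
    (IsLocalRing.maximalIdeal R).map (algebraMap R (Rees R M)) ≤ irrelevantIdeal R M := by
  rw [Ideal.map_le_iff_le_comap]
  intro r hr
  simpa [irrelevantIdeal] using hr

theorem reesι_mem_irrelevantIdeal (x : M) : reesι R M x ∈ irrelevantIdeal R M := by
  simp [irrelevantIdeal, reesAug, reesLift_reesι]

/-- If primes of the fiber cone that contain the `u_i` but not the irrelevant ideal have height at
least the dimension of the fiber cone, then the irrelevant ideal is minimal over the `u_i`. -/
theorem exists_mul_pow_mem_fiberIdeal {K : Ideal (Rees R M)}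
    (hK : K = (IsLocalRing.maximalIdeal R).map (algebraMap R (Rees R M))) {d : ℕ} {u : Fin d → M}
    (h : ringKrullDim (Rees R M ⧸ K) = d)
    (hu : ∀ Q : Ideal (Rees R M ⧸ K), Q.IsPrime →
      (∀ i, Ideal.Quotient.mk K (reesι R M (u i)) ∈ Q) →
      (∃ x, Ideal.Quotient.mk K (reesι R M x) ∉ Q) → (d : ℕ∞) ≤ Q.height) (x : M) :
    ∃ s ∉ irrelevantIdeal R M, ∃ k, s * reesι R M x ^ k ∈ fiberIdeal u := by
  have hKJ : K ≤ fiberIdeal u := hK.trans_le (map_maximalIdeal_le_fiberIdeal u)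
  have hK𝔐 : K ≤ irrelevantIdeal R M := hK.trans_le map_maximalIdeal_le_irrelevantIdeal
  by_contra! hc
  -- A prime avoiding this product of monoids lies inside the irrelevant ideal and misses `x`. The
  -- inclusion is strict, so the irrelevant ideal would have height at least `d + 1` in a ring of
  -- dimension `d`.
  have hdisj : Disjoint (fiberIdeal (R := R) u : Set (Rees R M))
      ((irrelevantIdeal R M).primeCompl ⊔ Submonoid.powers (reesι R M x) : Submonoid (Rees R M)) := by
    rw [Set.disjoint_left]
    intro b hb hbS
    obtain ⟨s, hs, _, ⟨k, rfl⟩, rfl⟩ := Submonoid.mem_sup.1 hbS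
    exact hc s hs k hb
  obtain ⟨Q, hQ, hJQ, hQS⟩ := Ideal.exists_le_prime_disjoint (fiberIdeal u) _ hdisj
  have hQ𝔐 : Q ≤ irrelevantIdeal R M := by
    intro b hb
    by_contra hb'
    exact Set.disjoint_left.1 hQS hb (Submonoid.mem_sup_left hb')
  have hxQ : reesι R M x ∉ Q := fun hb =>
    Set.disjoint_left.1 hQS hb (Submonoid.mem_sup_right (Submonoid.mem_powers _))
  have hKQ := hKJ.trans hJQ
  have hmem : ∀ L : Ideal (Rees R M), K ≤ L → ∀ b,
      Ideal.Quotient.mk K b ∈ L.map (Ideal.Quotient.mk K) ↔ b ∈ L := fun L hL b => by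
    change b ∈ (L.map (Ideal.Quotient.mk K)).comap (Ideal.Quotient.mk K) ↔ _
    rw [Ideal.comap_map_mk hL]
  have hp1 := Ideal.isPrime_map_quotientMk_of_isPrime hKQ
  have hp2 := Ideal.isPrime_map_quotientMk_of_isPrime hK𝔐
  have hlt : Q.map (Ideal.Quotient.mk K) < (irrelevantIdeal R M).map (Ideal.Quotient.mk K) :=
    lt_of_le_of_ne (Ideal.map_mono hQ𝔐) fun heq => hxQ <| by
      rw [← hmem Q hKQ, heq, hmem (irrelevantIdeal R M) hK𝔐]
      exact reesι_mem_irrelevantIdeal x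
  have h1 := hu _ hp1 (fun i => (hmem Q hKQ _).2 (hJQ (Ideal.subset_span (Or.inr ⟨i, rfl⟩))))
    ⟨x, fun hb => hxQ ((hmem Q hKQ _).1 hb)⟩
  have h2 := (add_le_add_left h1 1).trans (Ideal.height_add_one_le_of_lt_of_isPrime hlt)
  have h3 := (WithBot.coe_le_coe.2 h2).trans Ideal.height_le_ringKrullDim_of_isPrime
  rw [h] at h3
  have h4 : d + 1 ≤ d := by exact_mod_cast h3
  omega

/-- Over a local ring with infinite residue field, a module of analytic spread `d` has a reduction
generated by `d` elements. -/
theorem exists_hasReduction [IsNoetherianRing R] [Module.Finite R M]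
    [Infinite (IsLocalRing.ResidueField R)] {d : ℕ} (h : analyticSpread R M = d) :
    ∃ N, HasReduction R M d N := by
  obtain ⟨K, hK⟩ : ∃ K, K = (IsLocalRing.maximalIdeal R).map (algebraMap R (Rees R M)) := ⟨_, rfl⟩
  have hdim : ringKrullDim (Rees R M ⧸ K) = d := by rw [hK, ← analyticSpread_eq, h]
  have hA : ∀ r ∈ IsLocalRing.maximalIdeal R, algebraMap R (Rees R M ⧸ K) r = 0 :=
    fun r hr => Ideal.Quotient.eq_zero_iff_mem.2 (hK ▸ Ideal.mem_map_of_mem _ hr)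
  obtain ⟨u, hu⟩ := exists_general_elements (A := Rees R M ⧸ K)
    hA ((Ideal.Quotient.mkₐ R K).toLinearMap ∘ₗ reesι R M) d
  have hgeneric := exists_mul_pow_mem_fiberIdeal hK hdim hu
  have hrad : Ideal.span (Set.range (reesι R M)) ≤ (fiberIdeal u).radical := by
    rw [Ideal.span_le]
    rintro _ ⟨x, rfl⟩
    obtain ⟨s, hs, k, hk⟩ := hgeneric x
    refine ⟨k, ?_⟩
    -- The degree `k` component of `s * x ^ k` is the degree zero component of `s` times `x ^ k`,
    -- and that component is a unit as `s` is not in the irrelevant ideal.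
    have h1 := coeff_coaction_mem_fiberIdeal u _ hk 1 k
    rw [one_mul, map_mul, coaction_of_mem_pow (Submodule.pow_mem_pow _ (reesι_mem_reesGens x) k),
      ← mul_assoc, coeff_mul_X_pow', if_pos le_rfl, Nat.sub_self, coeff_mul_C,
      coeff_zero_coaction] at h1
    have hunit : IsUnit (reesAug s) := by
      by_contra hcon
      exact hs hcon
    exact (Ideal.unit_mul_mem_iff_mem _ (hunit.map (algebraMap R (Rees R M)))).1 h1
  obtain ⟨N, hN⟩ := Ideal.exists_pow_le_of_le_radical_of_fg hrad (IsNoetherian.noetherian _)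
  refine ⟨N, u, ?_⟩
  -- Nakayama's lemma: being in `fiberIdeal u` only gives the reduction equation in degree `N + 1`
  -- modulo the maximal ideal.
  refine Submodule.le_of_le_smul_of_le_jacobson_bot (reesGens_fg.pow _)
    (IsLocalRing.maximalIdeal_le_jacobson ⊥) fun w hw => ?_
  have hwI : w ∈ (Ideal.span (Set.range (reesι R M))) ^ (N + 1) := by
    have hle : ∀ n, ∀ w ∈ reesGens R M ^ n, w ∈ (Ideal.span (Set.range (reesι R M))) ^ n := by
      intro n w hw
      induction hw using Submodule.pow_induction_on_left' with
      | algebraMap r => simp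
      | add x y i _ _ hx hy => exact add_mem hx hy
      | mem_mul m hm i x _ hx =>
        rw [Nat.succ_eq_add_one, pow_succ']
        exact Ideal.mul_mem_mul (Ideal.subset_span hm) hx
    exact hle _ w hw
  have hwJ : w ∈ fiberIdeal u := hN (Ideal.pow_le_pow_right (Nat.le_succ N) hwI)
  have h1 := coeff_succ_coaction_mem u N w hwJ 1
  rwa [one_mul, coaction_of_mem_pow hw, coeff_C_mul, coeff_X_pow_self, mul_one] at h1

end Spread
-- Squeezing the invariants
section Main

variable {R : Type*} [CommRing R]

theorem isIdealModule_one_of_ideal {I : Ideal R}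
    (h : 2 ≤ idealGrade I) : IsIdealModule 1 I := by
  refine ⟨⟨(LinearEquiv.funUnique (Fin 1) R R).symm⟩, ?_⟩
  rw [moduleGrade, Ideal.annihilator_quotient]
  exact h

theorem minGens_eq_of_hasReduction_zero [IsNoetherianRing R] {I : Ideal R} (hI : I ≠ ⊤) {d : ℕ}
    (h : HasReduction R I d 0) (hd : I.height = d) : minGens R I = d := by
  obtain ⟨u, hu⟩ := exists_span_eq_top_of_hasReduction_zero h
  refine le_antisymm (spanFinrank_top_le_of_span_range_eq_top hu) ?_
  have h1 := Ideal.height_le_spanFinrank I hI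
  rw [hd, ← Submodule.spanFinrank_top] at h1
  exact_mod_cast h1

section

variable [IsNoetherianRing R] {G : Type*} [AddCommGroup G] [Module R G] {e N : ℕ}
  {E : Submodule R G}

theorem IsIdealModule.finite (hE : IsIdealModule e E) : Module.Finite R E := by
  obtain ⟨⟨L⟩, -⟩ := hE
  have : Module.Finite R G := Module.Finite.equiv L.symm
  infer_instance

theorem IsIdealModule.height_fittingIdeal_eq_two (hE : IsIdealModule e E) (hEG : E < ⊤)
    (hN : HasReduction R E (e + 1) N) : (fittingIdeal R E e).height = 2 :=
  le_antisymm (hE.height_fittingIdeal.trans_le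
    (hE.height_annihilator_le_two_of_hasReduction hEG hN))
    (hE.two_le_idealGrade_fittingIdeal.trans (idealGrade_le_height _))

end

variable [IsLocalRing R]

/-- The fiber cone is nonzero, since the extended maximal ideal lies in the irrelevant ideal; this
excludes dimension `⊥`. -/
theorem exists_nat_analyticSpread_eq {M : Type*} [AddCommGroup M] [Module R M] {d : ℕ}
    (h : analyticSpread R M ≤ d) : ∃ c : ℕ, analyticSpread R M = c := by
  have hnt : Nontrivial
      (Rees R M ⧸ (IsLocalRing.maximalIdeal R).map (algebraMap R (Rees R M))) :=
    Ideal.Quotient.nontrivial_iff.2 fun htop =>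
      Ideal.IsPrime.ne_top (I := irrelevantIdeal R M) inferInstance
        (top_le_iff.1 (htop ▸ map_maximalIdeal_le_irrelevantIdeal))
  have hnn : 0 ≤ analyticSpread R M := by
    rw [analyticSpread_eq]
    exact ringKrullDim_nonneg_of_nontrivial
  generalize analyticSpread R M = x at h hnn
  induction x with
  | bot => simp at hnn
  | coe x =>
    induction x with
    | top =>
      have : (⊤ : ℕ∞) ≤ d := by exact_mod_cast h
      simp at this
    | coe c => exact ⟨c, rfl⟩

/-- The spread is at most `d` by the given reduction. Conversely, a reduction with as many elements
as the spread exists, and its size bounds the height. -/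
theorem analyticSpread_eq_height_of_hasReduction [IsNoetherianRing R]
    [Infinite (IsLocalRing.ResidueField R)] {I : Ideal R} (hI : I ≠ ⊤) {d N : ℕ}
    (h : HasReduction R I d N) (hd : I.height = d) : analyticSpread R I = d := by
  have hle := analyticSpread_le_of_hasReduction h
  obtain ⟨c, hc⟩ := exists_nat_analyticSpread_eq hle
  obtain ⟨N', hN'⟩ := exists_hasReduction hc
  have h1 := height_le_of_hasReduction hI hN'
  rw [hd] at h1
  have h2 : d ≤ c := by exact_mod_cast h1
  rw [hc] at hle ⊢
  have h3 : c ≤ d := by exact_mod_cast hle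
  rw [le_antisymm h3 h2]

variable [IsNoetherianRing R] {G : Type*} [AddCommGroup G] [Module R G] {e N : ℕ}
  {E : Submodule R G}

/-- Heights and reductions of generic Bourbaki ideals of an ideal module that has a reduction
generated by `e + 1` elements. -/
theorem bourbaki_of_hasReduction (he : 0 < e) (hE : IsIdealModule e E) (hEG : E < ⊤)
    (hN : HasReduction R E (e + 1) N) {n : ℕ} {a : Fin n → E}
    {I : Ideal (Nagata R (Fin n × Fin (e - 1)))} (hI : IsGoodGenericBourbakiIdeal R a e I) :
    I ≠ ⊤ ∧ HasReduction (Nagata R (Fin n × Fin (e - 1))) I 2 N ∧ I.height = 2 ∧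
      (fittingIdeal (Nagata R (Fin n × Fin (e - 1))) I 1).height = 2 ∧ idealGrade I = 2 := by
  have := hE.finite
  have hne := bourbaki_ne_top he hE hEG hI
  have hred := hasReduction_bourbaki he hN hI
  have hht : I.height = 2 := le_antisymm (height_le_of_hasReduction hne hred)
    (hI.2.2.trans (idealGrade_le_height I))
  refine ⟨hne, hred, hht, ?_, idealGrade_eq_two_of_height_eq_two hI.2.2 hht⟩
  -- The ideal is viewed as an ideal module of rank one inside `R''`, with annihilator `I` of the
  -- quotient.
  rw [(isIdealModule_one_of_ideal hI.2.2).height_fittingIdeal, Ideal.annihilator_quotient, hht]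

end Main

end DivisorsOfModule

open DivisorsOfModule
theorem proposition5p7 {R : Type*} [CommRing R] [IsLocalRing R] [IsNoetherianRing R]
    {G : Type*} [AddCommGroup G] [Module R G] (e : ℕ) (he : 0 < e)
    (E : Submodule R G) (hE : IsIdealModule e E) (hEG : E < ⊤) :
    (minGens R E = e + 1 →
      IsPrincipalClass R E e ∧
      idealGrade (fittingIdeal R E e) = 2 ∧ (fittingIdeal R E e).height = 2 ∧
      ∀ (n : ℕ) (a : Fin n → E) (I : Ideal (Nagata R (Fin n × Fin (e - 1)))),
        IsGoodGenericBourbakiIdeal R a e I →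
          IsPrincipalClass (Nagata R (Fin n × Fin (e - 1))) I 1 ∧ IsPrincipalClassIdeal I ∧
          I.height = 2 ∧ idealGrade I = 2) ∧
    (analyticSpread R E = ((e + 1 : ℕ) : WithBot ℕ∞) →
      Infinite (IsLocalRing.ResidueField R) →
      IsEquimultiple R E e ∧
      idealGrade (fittingIdeal R E e) = 2 ∧ (fittingIdeal R E e).height = 2 ∧
      ∀ (n : ℕ) (a : Fin n → E) (I : Ideal (Nagata R (Fin n × Fin (e - 1)))),
        IsGoodGenericBourbakiIdeal R a e I →
          IsEquimultiple (Nagata R (Fin n × Fin (e - 1))) I 1 ∧ IsEquimultipleIdeal I ∧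
          I.height = 2 ∧ idealGrade I = 2) := by
  have := hE.finite
  constructor
  · intro hμ
    obtain ⟨y, hy⟩ := exists_fin_span_eq_top_of_spanFinrank_le (R := R) (M := E) hμ.le
    -- The reduction number `0` is kept in passing to `I`, which turns the reduction of `I` into two
    -- generators.
    have hred := hasReduction_zero hy
    have hF := hE.height_fittingIdeal_eq_two hEG hred
    refine ⟨?_, idealGrade_eq_two_of_height_eq_two hE.two_le_idealGrade_fittingIdeal hF, hF,
      fun n a I hI => ?_⟩
    · rw [IsPrincipalClass, hμ, hF]
      push_cast
      ring
    · obtain ⟨hne, hredI, hht, hF1, hgr⟩ := bourbaki_of_hasReduction he hE hEG hred hI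
      have hμI := minGens_eq_of_hasReduction_zero hne hredI hht
      refine ⟨?_, ?_, hht, hgr⟩
      · rw [IsPrincipalClass, hμI, hF1]
        rfl
      · rw [IsPrincipalClassIdeal, hμI, hht]
        rfl
  · intro hℓ hinf
    obtain ⟨N, hred⟩ := exists_hasReduction hℓ
    have hF := hE.height_fittingIdeal_eq_two hEG hred
    refine ⟨?_, idealGrade_eq_two_of_height_eq_two hE.two_le_idealGrade_fittingIdeal hF, hF,
      fun n a I hI => ?_⟩
    · rw [IsEquimultiple, hℓ, hF]
      have : e + 1 + 1 = 2 + e := by omega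
      exact_mod_cast this
    · obtain ⟨hne, hredI, hht, hF1, hgr⟩ := bourbaki_of_hasReduction he hE hEG hred hI
      have hℓI := analyticSpread_eq_height_of_hasReduction hne hredI hht
      refine ⟨?_, ?_, hht, hgr⟩
      · rw [IsEquimultiple, hℓI, hF1]
        rfl
      · rw [IsEquimultipleIdeal, hℓI, hht]
        rfl
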